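/- Let $n,k,L\ge 1$ be integers. Consider $n$ items with latent scores $\theta^\star_1\ge\theta^\star_2\ge\dots\ge\theta^\star_n$, normalized by $\sum_{i}\theta^\star_i=0$, and put $\kappa:=e^{\theta^\star_1}/e^{\theta^\star_n}$ and, for $1\le K<n$, $\Delta_K:=\theta^\star_K-\theta^\star_{K+1}$. Let $\varphi:[n]\to[k]$ be a cluster labeling, $n_t:=|\{i:\varphi(i)=t\}|$, and let $0\le q<p_t\le 1$ for all $t\in[k]$. A random comparison graph on $[n]$ with edge set $\mathcal E$ contains each pair $\{i,j\}$, $i\ne j$, independently, with probability $p_t$ if $\varphi(i)=\varphi(j)=t$ and with probability $q$ if $\varphi(i)\neq\varphi(j)$. For every edge with $i>j$ one observes $L$ Bernoulli variables $y_{ij}^{(1)},\dots,y_{ij}^{(L)}$ with $$\mathbb P\bigl(y_{ij}^{(l)}=1\bigr)=\frac{e^{\theta^\star_j}}{e^{\theta^\star_i}+e^{\theta^\star_j}}$$ (so $y_{ij}^{(l)}=1$ means that $j$ beats $i$), all independent of each other and of the graph. The vanilla (unweighted) MLE is $$\widehat\theta:=\arg\min_{\theta\in\mathbb R^n:\ \sum_i\theta_i=0}\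 -\frac1L\sum_{(i,j)\in\mathcal E,\ i>j}\ \sum_{l=1}^L\log\left(y_{ij}^{(l)}\frac{e^{\theta_j}}{e^{\theta_i}+e^{\theta_j}}+\bigl(1-y_{ij}^{(l)}\bigr)\frac{e^{\theta_i}}{e^{\theta_i}+e^{\theta_j}}\right).$$ There are absolute constants $C_1,C_2,C_3,C_4,C_5>0$ such that the following holds for all such data. Suppose that $$nq\ge C_1\log n,\qquad nqL\ge C_2\kappa^4\log^3 n,$$ and that, for every $t\in[k]$, $$n_tp_t\ge C_1\log n,\qquad n^2q^2L\ge C_2\kappa^4\,n_tp_t\log^3 n.$$ Then, with probability at least $1-C_5n^{-10}$, the MLE $\widehat\theta$ exists, is unique, and satisfies $$\|\widehat\theta-\theta^\star\|_\infty\le C_3\,\kappa\sqrt{\frac{\log n}{nqL}},$$ and, on the same event, for every $1\le K<n$ with $\Delta_K>0$ and $$n^2qL\ge C_4\,\frac{\kappa^2\,n\log n}{\Delta_K^2},$$ the top-$K$ items are recovered exactly, i.e. the $K$ largest entries of $\widehat\theta$ are uniquely determined and are those with indices $1,\dots,K$. -/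

import Mathlib

open MeasureTheory ProbabilityTheory

noncomputable section

namespace ClusterRanking

/-- Unordered pairs of distinct items, stored as `(i, j)` with `i > j`. -/
abbrev Pair (n : ℕ) : Type := {e : Fin n × Fin n // e.2 < e.1}

/-- The number of items with label `t`. -/
def clusterSize {n k : ℕ} (φ : Fin n → Fin k) (t : Fin k) : ℕ :=
  (Finset.univ.filter fun i => φ i = t).card

/-- The sampling probability of a pair: `p t` inside cluster `t`, and `q` across clusters. -/
def edgeProb {n k : ℕ} (φ : Fin n → Fin k) (p : Fin k → ℝ) (q : ℝ) (e : Pair n) : ℝ :=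
  if φ e.1.1 = φ e.1.2 then p (φ e.1.1) else q

/-- The Bradley-Terry-Luce probability that item `a` beats item `b`. -/
def winProb {n : ℕ} (θ : Fin n → ℝ) (a b : Fin n) : ℝ :=
  Real.exp (θ a) / (Real.exp (θ a) + Real.exp (θ b))

/-- Clustered sampling of a comparison graph, with `L` Bradley-Terry-Luce comparisons per edge.
`edge e` says whether the pair `e` is compared. For `e = (i, j)` with `i > j`, `outcome e l` is the
`l`-th result `y_ij^(l)`; it is `true` when `j` beats `i`. Results are defined for all pairs, but
only those on the edges of the graph enter the likelihood. -/
structure IsClusteredBTL {Ω : Type*} [MeasurableSpace Ω] (μ : Measure Ω) {n k L : ℕ}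
    (φ : Fin n → Fin k) (p : Fin k → ℝ) (q : ℝ) (θ : Fin n → ℝ)
    (edge : Pair n → Ω → Bool) (outcome : Pair n → Fin L → Ω → Bool) : Prop where
  measurable_edge : ∀ e, Measurable (edge e)
  measurable_outcome : ∀ e l, Measurable (outcome e l)
  prob_edge : ∀ e, μ.real {ω | edge e ω = true} = edgeProb φ p q e
  prob_outcome : ∀ e l, μ.real {ω | outcome e l ω = true} = winProb θ e.1.2 e.1.1
  /-- All edge indicators and all comparison results are mutually independent. -/
  indep : iIndepFun
    (Sum.elim edge (fun s : Pair n × Fin L => outcome s.1 s.2) :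
      Pair n ⊕ (Pair n × Fin L) → Ω → Bool) μ

/-- The weighted negative log-likelihood
`-(1/L) ∑_{i > j} ∑_l w_ij log (probability under θ of the observed result)`. -/
def weightedLoss {n L : ℕ} (w : Pair n → ℝ) (y : Pair n → Fin L → Bool) (θ : Fin n → ℝ) : ℝ :=
  -(1 / (L : ℝ)) * ∑ e : Pair n, ∑ l : Fin L,
    w e * Real.log (if y e l then winProb θ e.1.2 e.1.1 else winProb θ e.1.1 e.1.2)

/-- `x` is a weighted maximum likelihood estimate: it minimizes the loss over the vectors whose
entries sum to zero. -/
def IsWeightedMLE {n L : ℕ} (w : Pair n → ℝ) (y : Pair n → Fin L → Bool) (x : Fin n → ℝ) : Prop :=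
  ∑ i, x i = 0 ∧
    ∀ x' : Fin n → ℝ, ∑ i, x' i = 0 → weightedLoss w y x ≤ weightedLoss w y x'

/-- The vanilla (unweighted) MLE on a comparison graph: weight `1` on its edges, `0` elsewhere. -/
def IsMLE {n L : ℕ} (g : Pair n → Bool) (y : Pair n → Fin L → Bool) (x : Fin n → ℝ) : Prop :=
  IsWeightedMLE (fun e => if g e then 1 else 0) y x

/-- The condition number `κ = exp θ_1 / exp θ_n` of a non-increasing score vector. -/
def kappa {n : ℕ} (hn : 0 < n) (θ : Fin n → ℝ) : ℝ :=
  Real.exp (θ ⟨0, hn⟩) / Real.exp (θ ⟨n - 1, Nat.sub_lt hn Nat.one_pos⟩)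

/-- The gap `Δ_K = θ_K - θ_{K+1}` (items counted from one), for `1 ≤ K < n`. -/
def scoreGap {n : ℕ} (θ : Fin n → ℝ) (K : ℕ) (hKn : K < n) : ℝ :=
  θ ⟨K - 1, lt_of_le_of_lt (Nat.sub_le K 1) hKn⟩ - θ ⟨K, hKn⟩

/-- `S` is a possible selection of the `K` largest entries of `x`. -/
def IsTopK {n : ℕ} (x : Fin n → ℝ) (K : ℕ) (S : Finset (Fin n)) : Prop :=
  S.card = K ∧ ∀ i ∈ S, ∀ j ∉ S, x j ≤ x i

/-- Exact recovery: the first `K` items are the one and only selection of the `K` largest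
entries of `x`. -/
def RecoversTopK {n : ℕ} (x : Fin n → ℝ) (K : ℕ) : Prop :=
  ∀ S : Finset (Fin n), IsTopK x K S ↔ S = Finset.univ.filter fun i : Fin n => (i : ℕ) < K

end ClusterRanking

end

/-!
Every pair is compared with probability at least `q`, so Chernoff bounds and a union bound over cuts
show that with high probability the comparison graph expands like an Erdős–Rényi graph of edge
probability `q`. Integrating the expansion over superlevel sets gives a spectral gap; the Hessian of
the loss at `θ` is the Laplacian of the same graph with conductances between `1 / (4 κ)` and `1`,
so it loses at most a factor of order `κ`.

To bound the error in `ℓ^∞` rather than `ℓ²`, a Newton step of the loss is tested against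
approximate Green functions of the Hessian, namely occupation densities of the lazy random walk.
Their energy, bounded through the spectral gap, is the variance proxy in Hoeffding's inequality for
the noise conditionally on the graph. Their total variation, which weighs the Taylor remainder, is
bounded by testing the Poisson equation they solve against their logarithm, as in an entropy
estimate, and applying the Cauchy–Schwarz inequality.

The loss has a minimizer over the `ℓ^∞` ball of radius `ε` around `θ`. Tested against the Green
functions, its Newton step lands in the ball of radius `ε / 2`, so a minimizer over the ball is a
critical point of the loss, and strict convexity makes it the unique global minimizer.
-/

noncomputable section

namespace ClusterRanking

open scoped Finset

section Laplacian

variable {V : Type*} [Fintype V]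

/-- The Laplacian `D - W` of the weighted graph on `V` with conductances `W`, acting on functions.
Symmetry and nonnegativity of `W` are hypotheses of the individual lemmas. -/
def laplacian (W : V → V → ℝ) : Module.End ℝ (V → ℝ) where
  toFun x i := ∑ j, W i j * (x i - x j)
  map_add' x y := by
    funext i
    simp only [Pi.add_apply, ← Finset.sum_add_distrib]
    exact Finset.sum_congr rfl fun j _ => by ring
  map_smul' c x := by
    funext i
    simp only [Pi.smul_apply, smul_eq_mul, RingHom.id_apply, Finset.mul_sum]
    exact Finset.sum_congr rfl fun j _ => by ring

/-- The Dirichlet energy of a function on a weighted graph; the factor `1 / 2` compensates for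
counting each edge in both directions. -/
def energy (W : V → V → ℝ) (x : V → ℝ) : ℝ := 1 / 2 * ∑ i, ∑ j, W i j * (x i - x j) ^ 2

/-- The total variation of a function on a weighted graph, with each edge counted in both
directions. -/
def totalVariation (W : V → V → ℝ) (x : V → ℝ) : ℝ := ∑ i, ∑ j, W i j * |x i - x j|

/-- The Poincaré inequality: on functions of mean zero the Dirichlet energy dominates `Λ` times the
squared `ℓ²` norm, that is, the second smallest Laplacian eigenvalue is at least `Λ`. -/
def HasSpectralGap (W : V → V → ℝ) (Λ : ℝ) : Prop :=
  ∀ x : V → ℝ, ∑ i, x i = 0 → Λ * ∑ i, x i ^ 2 ≤ energy W x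

variable {W : V → V → ℝ}

lemma laplacian_apply (W : V → V → ℝ) (x : V → ℝ) (i : V) :
    laplacian W x i = ∑ j, W i j * (x i - x j) := rfl

lemma laplacian_sub_const (W : V → V → ℝ) (x : V → ℝ) (c : ℝ) :
    laplacian W (fun j => x j - c) = laplacian W x := by
  funext i
  simp only [laplacian_apply, sub_sub_sub_cancel_right]

lemma energy_sub_const (W : V → V → ℝ) (x : V → ℝ) (c : ℝ) :
    energy W (fun j => x j - c) = energy W x := by
  simp only [energy, sub_sub_sub_cancel_right]

lemma energy_nonneg (hnonneg : ∀ i j, 0 ≤ W i j) (x : V → ℝ) : 0 ≤ energy W x :=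
  mul_nonneg one_half_pos.le <| Finset.sum_nonneg fun i _ => Finset.sum_nonneg fun j _ =>
    mul_nonneg (hnonneg i j) (sq_nonneg _)

lemma sum_mul_laplacian (hsymm : ∀ i j, W i j = W j i) (y x : V → ℝ) :
    ∑ i, y i * laplacian W x i = 1 / 2 * ∑ i, ∑ j, W i j * ((y i - y j) * (x i - x j)) := by
  have expand : ∑ i, y i * laplacian W x i = ∑ i, ∑ j, W i j * (y i * (x i - x j)) := by
    simp only [laplacian_apply, Finset.mul_sum]
    exact Finset.sum_congr rfl fun i _ => Finset.sum_congr rfl fun j _ => by ring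
  have swap : ∑ i, ∑ j, W i j * (y i * (x i - x j)) = ∑ i, ∑ j, W i j * (y j * (x j - x i)) := by
    rw [Finset.sum_comm]
    exact Finset.sum_congr rfl fun i _ => Finset.sum_congr rfl fun j _ => by rw [hsymm]
  have split : ∑ i, ∑ j, W i j * ((y i - y j) * (x i - x j)) =
      ∑ i, ∑ j, W i j * (y i * (x i - x j)) + ∑ i, ∑ j, W i j * (y j * (x j - x i)) := by
    simp only [← Finset.sum_add_distrib]
    exact Finset.sum_congr rfl fun i _ => Finset.sum_congr rfl fun j _ => by ring
  rw [split, ← swap, expand]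
  ring

lemma sum_mul_laplacian_comm (hsymm : ∀ i j, W i j = W j i) (y x : V → ℝ) :
    ∑ i, y i * laplacian W x i = ∑ i, x i * laplacian W y i := by
  rw [sum_mul_laplacian hsymm, sum_mul_laplacian hsymm]
  simp only [mul_comm]

lemma sum_mul_laplacian_self (hsymm : ∀ i j, W i j = W j i) (x : V → ℝ) :
    ∑ i, x i * laplacian W x i = energy W x := by
  simp only [sum_mul_laplacian hsymm, energy, sq]

lemma sum_laplacian (hsymm : ∀ i j, W i j = W j i) (x : V → ℝ) : ∑ i, laplacian W x i = 0 := by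
  simpa using sum_mul_laplacian hsymm (fun _ => 1) x

lemma sum_sq_laplacian_le (hnonneg : ∀ i j, 0 ≤ W i j)
    {D : ℝ} (hdeg : ∀ i, ∑ j, W i j ≤ D) (x : V → ℝ) :
    ∑ i, laplacian W x i ^ 2 ≤ 2 * D * energy W x := by
  have row (i : V) : laplacian W x i ^ 2 ≤ D * ∑ j, W i j * (x i - x j) ^ 2 := by
    have cauchy := Finset.sum_sq_le_sum_mul_sum_of_sq_le_mul Finset.univ
      (r := fun j => W i j * (x i - x j)) (f := fun j => W i j)
      (g := fun j => W i j * (x i - x j) ^ 2) (fun j _ => hnonneg i j)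
      (fun j _ => mul_nonneg (hnonneg i j) (sq_nonneg _)) (fun j _ => le_of_eq (by ring))
    exact cauchy.trans (mul_le_mul_of_nonneg_right (hdeg i)
      (Finset.sum_nonneg fun j _ => mul_nonneg (hnonneg i j) (sq_nonneg _)))
  calc ∑ i, laplacian W x i ^ 2 ≤ ∑ i, D * ∑ j, W i j * (x i - x j) ^ 2 :=
        Finset.sum_le_sum fun i _ => row i
    _ = 2 * D * energy W x := by rw [← Finset.mul_sum, energy]; ring

lemma HasSpectralGap.energy_le_of_sum_sq_laplacian_le (hsymm : ∀ i j, W i j = W j i)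
    (hnonneg : ∀ i j, 0 ≤ W i j) {Λ : ℝ} (hΛ : 0 < Λ) (hgap : HasSpectralGap W Λ) {u : V → ℝ}
    {b : ℝ} (hu : ∑ j, laplacian W u j ^ 2 ≤ b) : energy W u ≤ b / Λ := by
  let c : ℝ := (∑ j, u j) / Fintype.card V
  have hv_mean : ∑ j, (u j - c) = 0 := by
    rcases isEmpty_or_nonempty V with _ | _
    · simp
    · simp [c, Finset.sum_sub_distrib, field]
  rw [← energy_sub_const W u c]
  rw [← laplacian_sub_const W u c] at hu
  set v : V → ℝ := fun j => u j - c
  have hE : 0 ≤ energy W v := energy_nonneg hnonneg v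
  have hS : 0 ≤ ∑ j, v j ^ 2 := Finset.sum_nonneg fun j _ => sq_nonneg _
  have cauchy : energy W v ^ 2 ≤ (∑ j, v j ^ 2) * b := by
    rw [← sum_mul_laplacian_self hsymm]
    exact (Finset.sum_mul_sq_le_sq_mul_sq _ _ _).trans (mul_le_mul_of_nonneg_left hu hS)
  have hb : 0 ≤ b := (Finset.sum_nonneg fun j _ => sq_nonneg _).trans hu
  rw [le_div_iff₀ hΛ]
  rcases hE.eq_or_lt with h | h
  · simpa [← h] using hb
  · have : energy W v * (energy W v * Λ) ≤ energy W v * b := by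
      nlinarith [hgap v hv_mean]
    exact le_of_mul_le_mul_left this h

lemma HasSpectralGap.le_two_mul_degree (hsymm : ∀ i j, W i j = W j i)
    (hnonneg : ∀ i j, 0 ≤ W i j) [Nontrivial V] {D Λ : ℝ} (hdeg : ∀ i, ∑ j, W i j ≤ D)
    (hgap : HasSpectralGap W Λ) : Λ ≤ 2 * D := by
  classical
  obtain ⟨a, b, hab⟩ := exists_pair_ne V
  let x : V → ℝ := Pi.single a 1 - Pi.single b 1
  have hx : ∑ i, x i = 0 := by simp [x, Finset.sum_sub_distrib]
  have hpos : 0 < ∑ i, x i ^ 2 :=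
    Finset.sum_pos' (fun i _ => sq_nonneg _) ⟨a, Finset.mem_univ _, by simp [x, hab]⟩
  have hD : 0 ≤ D := (Finset.sum_nonneg fun j _ => hnonneg a j).trans (hdeg a)
  have hE : 0 ≤ energy W x := energy_nonneg hnonneg x
  have cauchy : energy W x ^ 2 ≤ (∑ i, x i ^ 2) * (2 * D * energy W x) := by
    rw [← sum_mul_laplacian_self hsymm]
    refine (Finset.sum_mul_sq_le_sq_mul_sq _ _ _).trans (mul_le_mul_of_nonneg_left ?_ hpos.le)
    rw [sum_mul_laplacian_self hsymm]
    exact sum_sq_laplacian_le hnonneg hdeg x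
  have henergy : energy W x ≤ 2 * D * ∑ i, x i ^ 2 := by
    rcases hE.eq_or_lt with h | h
    · rw [← h]; positivity
    · nlinarith
  nlinarith [hgap x hx]

lemma HasSpectralGap.eq_zero_of_energy_nonpos {Λ : ℝ} (hΛ : 0 < Λ) (hgap : HasSpectralGap W Λ)
    {x : V → ℝ} (hx : ∑ i, x i = 0) (henergy : energy W x ≤ 0) : x = 0 := by
  have hsum : ∑ i, x i ^ 2 = 0 :=
    le_antisymm (nonpos_of_mul_nonpos_right ((hgap x hx).trans henergy) hΛ)
      (Finset.sum_nonneg fun i _ => sq_nonneg _)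
  have hzero := (Fintype.sum_eq_zero_iff_of_nonneg fun i => sq_nonneg (x i)).mp hsum
  funext i
  simpa using congrFun hzero i

lemma HasSpectralGap.exists_laplacian_eq (hsymm : ∀ i j, W i j = W j i) {Λ : ℝ} (hΛ : 0 < Λ)
    (hgap : HasSpectralGap W Λ) {b : V → ℝ} (hb : ∑ i, b i = 0) :
    ∃ x : V → ℝ, ∑ i, x i = 0 ∧ laplacian W x = b := by
  let M : Submodule ℝ (V → ℝ) := LinearMap.ker (∑ i, LinearMap.proj i)
  have mem_M (x : V → ℝ) : x ∈ M ↔ ∑ i, x i = 0 := by simp [M, LinearMap.sum_apply]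
  let L : Module.End ℝ M :=
    (laplacian W).restrict fun x _ => (mem_M _).mpr (sum_laplacian hsymm x)
  have hL : Function.Injective L := by
    rw [← LinearMap.ker_eq_bot, LinearMap.ker_eq_bot']
    rintro ⟨x, hx⟩ hLx
    have hlap : laplacian W x = 0 := congrArg Subtype.val hLx
    have henergy : energy W x = 0 := by rw [← sum_mul_laplacian_self hsymm, hlap]; simp
    exact Subtype.ext (hgap.eq_zero_of_energy_nonpos hΛ ((mem_M x).mp hx) henergy.le)
  obtain ⟨⟨x, hx⟩, hLx⟩ := LinearMap.injective_iff_surjective.mp hL ⟨b, (mem_M b).mpr hb⟩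
  exact ⟨x, (mem_M x).mp hx, congrArg Subtype.val hLx⟩

lemma sum_sum_mul_add_le (hsymm : ∀ i j, W i j = W j i) {D : ℝ} (hdeg : ∀ i, ∑ j, W i j ≤ D)
    {x : V → ℝ} (hx : ∀ i, 0 ≤ x i) : ∑ a, ∑ b, W a b * (x a + x b) ≤ 2 * D * ∑ a, x a := by
  have swap : ∑ a, ∑ b, W a b * x b = ∑ a, ∑ b, W a b * x a := by
    rw [Finset.sum_comm]
    exact Finset.sum_congr rfl fun a _ => Finset.sum_congr rfl fun b _ => by rw [hsymm]
  calc ∑ a, ∑ b, W a b * (x a + x b) = 2 * ∑ a, (∑ b, W a b) * x a := by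
        simp only [mul_add, Finset.sum_add_distrib, swap, Finset.sum_mul]; ring
    _ ≤ 2 * ∑ a, D * x a := by gcongr with a; exacts [hx a, hdeg a]
    _ = 2 * D * ∑ a, x a := by rw [← Finset.mul_sum]; ring

lemma sq_sub_le_mul_log_sub {a b : ℝ} (ha : 0 < a) (hb : 0 < b) :
    (a - b) ^ 2 ≤ (Real.log a - Real.log b) * (a - b) * (a + b) := by
  wlog h : b ≤ a generalizing a b
  · linarith [this hb ha (by linarith)]
  have hlog : 0 ≤ Real.log a - Real.log b := sub_nonneg.mpr (Real.log_le_log hb h)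
  have key : a - b ≤ (Real.log a - Real.log b) * a := by
    have := Real.one_sub_inv_le_log_of_pos (div_pos ha hb)
    rw [inv_div, Real.log_div ha.ne' hb.ne', one_sub_div ha.ne', div_le_iff₀ ha] at this
    exact this
  nlinarith [mul_nonneg (sub_nonneg.mpr h) (mul_nonneg hlog hb.le),
    mul_le_mul_of_nonneg_left key (sub_nonneg.mpr h)]

lemma sq_totalVariation_le_log_dissipation (hsymm : ∀ i j, W i j = W j i)
    (hnonneg : ∀ i j, 0 ≤ W i j) {D : ℝ} (hdeg : ∀ i, ∑ j, W i j ≤ D) {x : V → ℝ}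
    (hx : ∀ i, 0 < x i) :
    totalVariation W x ^ 2 ≤
      (2 * ∑ i, Real.log (x i) * laplacian W x i) * (2 * D * ∑ i, x i) := by
  have log_mul_nonneg (a b : V) : 0 ≤ (Real.log (x a) - Real.log (x b)) * (x a - x b) := by
    rcases le_total (x a) (x b) with h | h
    · exact mul_nonneg_of_nonpos_of_nonpos (sub_nonpos.mpr (Real.log_le_log (hx a) h))
        (sub_nonpos.mpr h)
    · exact mul_nonneg (sub_nonneg.mpr (Real.log_le_log (hx b) h)) (sub_nonneg.mpr h)
  have cauchy := Finset.sum_sq_le_sum_mul_sum_of_sq_le_mul (Finset.univ : Finset (V × V))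
    (r := fun e => W e.1 e.2 * |x e.1 - x e.2|)
    (f := fun e => W e.1 e.2 * ((Real.log (x e.1) - Real.log (x e.2)) * (x e.1 - x e.2)))
    (g := fun e => W e.1 e.2 * (x e.1 + x e.2))
    (fun e _ => mul_nonneg (hnonneg _ _) (log_mul_nonneg _ _))
    (fun e _ => mul_nonneg (hnonneg _ _) (add_pos (hx _) (hx _)).le)
    (fun e _ => by
      rw [mul_pow, sq_abs]
      exact (mul_le_mul_of_nonneg_left (sq_sub_le_mul_log_sub (hx e.1) (hx e.2))
        (sq_nonneg (W e.1 e.2))).trans_eq (by ring))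
  simp only [Fintype.sum_prod_type] at cauchy
  have dissipation : 2 * ∑ i, Real.log (x i) * laplacian W x i =
      ∑ i, ∑ j, W i j * ((Real.log (x i) - Real.log (x j)) * (x i - x j)) := by
    rw [sum_mul_laplacian hsymm]; ring
  rw [dissipation]
  refine cauchy.trans (mul_le_mul_of_nonneg_left
    (sum_sum_mul_add_le hsymm hdeg fun i => (hx i).le) ?_)
  exact Finset.sum_nonneg fun a _ => Finset.sum_nonneg fun b _ =>
    mul_nonneg (hnonneg a b) (log_mul_nonneg a b)

lemma sum_log_mul_single_sub_le [DecidableEq V] {x π : V → ℝ} {c : ℝ} (hc : 0 < c)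
    (hx : ∀ j, c ≤ x j) (hπ : ∀ j, 0 ≤ π j) (hπ_sum : ∑ j, π j = 1) (i : V) :
    ∑ j, Real.log (x j) * (Pi.single i 1 - π : V → ℝ) j ≤ Real.log (x i / c) := by
  have hmean : Real.log c ≤ ∑ j, Real.log (x j) * π j := by
    calc Real.log c = ∑ j, Real.log c * π j := by rw [← Finset.mul_sum, hπ_sum, mul_one]
      _ ≤ ∑ j, Real.log (x j) * π j := Finset.sum_le_sum fun j _ =>
        mul_le_mul_of_nonneg_right (Real.log_le_log hc (hx j)) (hπ j)
  have hsplit : ∑ j, Real.log (x j) * (Pi.single i 1 - π : V → ℝ) j =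
      Real.log (x i) - ∑ j, Real.log (x j) * π j := by
    simp [mul_sub, Finset.sum_sub_distrib, Pi.single_apply]
  rw [hsplit, Real.log_div (hc.trans_le (hx i)).ne' hc.ne']
  linarith

/- The entropy estimate is applied to `u + c`, which is bounded away from zero: the shift costs only
a logarithm in the dissipation and `c * card V` in the mass. -/
lemma sq_totalVariation_le [DecidableEq V] (hsymm : ∀ i j, W i j = W j i)
    (hnonneg : ∀ i j, 0 ≤ W i j) {D : ℝ} (hdeg : ∀ i, ∑ j, W i j ≤ D) {u π : V → ℝ} {i : V}
    (hu : ∀ j, 0 ≤ u j) (hπ : ∀ j, 0 ≤ π j) (hπ_sum : ∑ j, π j = 1)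
    (hlap : laplacian W u = Pi.single i 1 - π) {c : ℝ} (hc : 0 < c) :
    totalVariation W u ^ 2 ≤
      (2 * Real.log ((∑ j, u j + c) / c)) * (2 * D * (∑ j, u j + Fintype.card V * c)) := by
  let x : V → ℝ := fun j => u j - -c
  have hx (j : V) : c ≤ x j := by simp [x, hu j]
  have hTV : totalVariation W u = totalVariation W x := by
    simp only [totalVariation, x, sub_sub_sub_cancel_right]
  have hmass : ∑ j, x j = ∑ j, u j + Fintype.card V * c := by simp [x, Finset.sum_add_distrib]
  have hD : 0 ≤ D := (Finset.sum_nonneg fun j _ => hnonneg i j).trans (hdeg i)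
  have hmass_nonneg : 0 ≤ ∑ j, x j := Finset.sum_nonneg fun j _ => hc.le.trans (hx j)
  have hxi : x i ≤ ∑ j, u j + c := by
    simpa [x] using Finset.single_le_sum (fun j _ => hu j) (Finset.mem_univ i)
  have hdissipation : ∑ j, Real.log (x j) * laplacian W x j ≤
      Real.log ((∑ j, u j + c) / c) := by
    rw [laplacian_sub_const, hlap]
    refine (sum_log_mul_single_sub_le hc hx hπ hπ_sum i).trans (Real.log_le_log ?_ ?_)
    · exact div_pos (hc.trans_le (hx i)) hc
    · gcongr
  rw [hTV, ← hmass]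
  refine (sq_totalVariation_le_log_dissipation hsymm hnonneg hdeg
    fun j => hc.trans_le (hx j)).trans ?_
  gcongr

end Laplacian

section GreenFunction

variable {V : Type*} [Fintype V] {W : V → V → ℝ}

/-- One step of the lazy random walk which crosses the edge `{i, j}` at rate `W i j / (2 * D)`, as
an operator on functions; it is stochastic when `D` bounds all weighted degrees. -/
def lazyWalk (W : V → V → ℝ) (D : ℝ) : Module.End ℝ (V → ℝ) := 1 - (2 * D)⁻¹ • laplacian W

lemma lazyWalk_apply (W : V → V → ℝ) (D : ℝ) (x : V → ℝ) (i : V) :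
    lazyWalk W D x i = x i - (2 * D)⁻¹ * laplacian W x i := rfl

lemma lazyWalk_sub_const (W : V → V → ℝ) (D : ℝ) (x : V → ℝ) (c : ℝ) :
    lazyWalk W D (fun j => x j - c) = fun j => lazyWalk W D x j - c := by
  funext i
  simp only [lazyWalk_apply, laplacian_sub_const]
  ring

lemma sum_lazyWalk (hsymm : ∀ i j, W i j = W j i) (D : ℝ) (x : V → ℝ) :
    ∑ i, lazyWalk W D x i = ∑ i, x i := by
  simp [lazyWalk_apply, Finset.sum_sub_distrib, ← Finset.mul_sum, sum_laplacian hsymm]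

lemma lazyWalk_nonneg (hnonneg : ∀ i j, 0 ≤ W i j) {D : ℝ} (hD : 0 < D)
    (hdeg : ∀ i, ∑ j, W i j ≤ D) {x : V → ℝ} (hx : ∀ i, 0 ≤ x i) (i : V) :
    0 ≤ lazyWalk W D x i := by
  have hlap : laplacian W x i ≤ D * x i := by
    calc laplacian W x i ≤ ∑ j, W i j * x i :=
          Finset.sum_le_sum fun j _ =>
            mul_le_mul_of_nonneg_left (sub_le_self _ (hx j)) (hnonneg i j)
      _ = (∑ j, W i j) * x i := by rw [Finset.sum_mul]
      _ ≤ D * x i := mul_le_mul_of_nonneg_right (hdeg i) (hx i)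
  rw [lazyWalk_apply, sub_nonneg, inv_mul_le_iff₀ (by positivity)]
  nlinarith [mul_nonneg hD.le (hx i)]

lemma HasSpectralGap.sum_sq_lazyWalk_le (hsymm : ∀ i j, W i j = W j i)
    (hnonneg : ∀ i j, 0 ≤ W i j) {D Λ : ℝ} (hD : 0 < D) (hdeg : ∀ i, ∑ j, W i j ≤ D)
    (hgap : HasSpectralGap W Λ) {x : V → ℝ} (hx : ∑ i, x i = 0) :
    ∑ i, lazyWalk W D x i ^ 2 ≤ Real.exp (-(Λ / (2 * D))) * ∑ i, x i ^ 2 := by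
  have expand : ∑ i, lazyWalk W D x i ^ 2 = ∑ i, x i ^ 2 - energy W x / D +
      (∑ i, laplacian W x i ^ 2) / (4 * D ^ 2) := by
    rw [← sum_mul_laplacian_self hsymm, Finset.sum_div, Finset.sum_div, ← Finset.sum_sub_distrib,
      ← Finset.sum_add_distrib]
    refine Finset.sum_congr rfl fun i _ => ?_
    rw [lazyWalk_apply]
    field
  have second_order : (∑ i, laplacian W x i ^ 2) / (4 * D ^ 2) ≤ energy W x / (2 * D) := by
    calc (∑ i, laplacian W x i ^ 2) / (4 * D ^ 2) ≤ 2 * D * energy W x / (4 * D ^ 2) := by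
          gcongr; exact sum_sq_laplacian_le hnonneg hdeg x
      _ = energy W x / (2 * D) := by field
  calc ∑ i, lazyWalk W D x i ^ 2 ≤ ∑ i, x i ^ 2 - energy W x / (2 * D) := by
        rw [expand, show energy W x / D = 2 * (energy W x / (2 * D)) by field]
        linarith
    _ ≤ ∑ i, x i ^ 2 - Λ * (∑ i, x i ^ 2) / (2 * D) := by gcongr; exact hgap x hx
    _ = (1 - Λ / (2 * D)) * ∑ i, x i ^ 2 := by ring
    _ ≤ Real.exp (-(Λ / (2 * D))) * ∑ i, x i ^ 2 := by
        gcongr; exact Real.one_sub_le_exp_neg _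

/-- The occupation density of the first `T` steps of the lazy walk. It is a truncation of the
Green's function: on functions of mean zero it converges to the inverse of the Laplacian. -/
def truncatedGreen (W : V → V → ℝ) (D : ℝ) (T : ℕ) : Module.End ℝ (V → ℝ) :=
  (2 * D)⁻¹ • ∑ t ∈ Finset.range T, lazyWalk W D ^ t

lemma laplacian_truncatedGreen (W : V → V → ℝ) {D : ℝ} (hD : D ≠ 0) (T : ℕ) (x : V → ℝ) :
    laplacian W (truncatedGreen W D T x) = x - (lazyWalk W D ^ T) x := by
  have hlap : laplacian W = (2 * D) • (1 - lazyWalk W D) := by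
    rw [lazyWalk, sub_sub_cancel, smul_inv_smul₀ (by positivity)]
  have : laplacian W * truncatedGreen W D T = 1 - lazyWalk W D ^ T := by
    rw [hlap, truncatedGreen, smul_mul_smul_comm, mul_inv_cancel₀ (by positivity), one_smul,
      mul_neg_geom_sum]
  rw [← Module.End.mul_apply, this]
  rfl

variable [DecidableEq V]

lemma lazyWalk_pow_single_nonneg (hnonneg : ∀ i j, 0 ≤ W i j) {D : ℝ} (hD : 0 < D)
    (hdeg : ∀ i, ∑ j, W i j ≤ D) (i : V) (t : ℕ) (j : V) :
    0 ≤ (lazyWalk W D ^ t) (Pi.single i 1) j := by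
  induction t generalizing j with
  | zero => exact (Pi.single_nonneg.mpr zero_le_one : 0 ≤ (Pi.single i 1 : V → ℝ)) j
  | succ t ih => rw [pow_succ', Module.End.mul_apply]; exact lazyWalk_nonneg hnonneg hD hdeg ih j

lemma sum_lazyWalk_pow_single (hsymm : ∀ i j, W i j = W j i) (D : ℝ) (i : V) (t : ℕ) :
    ∑ j, (lazyWalk W D ^ t) (Pi.single i 1) j = 1 := by
  induction t with
  | zero => simp
  | succ t ih => rw [pow_succ', Module.End.mul_apply, sum_lazyWalk hsymm, ih]

lemma sum_sq_single_sub_inv_card_le (i : V) :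
    ∑ j, ((Pi.single i 1 : V → ℝ) j - 1 / Fintype.card V) ^ 2 ≤ 1 := by
  have : Nonempty V := ⟨i⟩
  calc ∑ j, ((Pi.single i 1 : V → ℝ) j - 1 / Fintype.card V) ^ 2
      = ∑ j, ((Pi.single i 1 : V → ℝ) j * (1 - 2 / Fintype.card V) +
          (1 / Fintype.card V : ℝ) ^ 2) := by
        refine Finset.sum_congr rfl fun j _ => ?_
        rcases eq_or_ne j i with rfl | h
        · simp only [Pi.single_eq_same]; ring
        · simp [h]
    _ = 1 - 1 / (Fintype.card V : ℝ) := by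
        simp [Finset.sum_add_distrib, Pi.single_apply]
        field
    _ ≤ 1 := sub_le_self _ (by positivity)

lemma HasSpectralGap.sum_sq_lazyWalk_pow_sub_le (hsymm : ∀ i j, W i j = W j i)
    (hnonneg : ∀ i j, 0 ≤ W i j) {D Λ : ℝ} (hD : 0 < D) (hdeg : ∀ i, ∑ j, W i j ≤ D)
    (hgap : HasSpectralGap W Λ) (i : V) (t : ℕ) :
    ∑ j, ((lazyWalk W D ^ t) (Pi.single i 1) j - 1 / Fintype.card V) ^ 2 ≤
      Real.exp (-(Λ / (2 * D) * t)) := by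
  have : Nonempty V := ⟨i⟩
  induction t with
  | zero => simpa using sum_sq_single_sub_inv_card_le i
  | succ t ih =>
    have hmean : ∑ j, ((lazyWalk W D ^ t) (Pi.single i 1) j - 1 / Fintype.card V) = 0 := by
      rw [Finset.sum_sub_distrib, sum_lazyWalk_pow_single hsymm]; simp
    have contraction := hgap.sum_sq_lazyWalk_le hsymm hnonneg hD hdeg hmean
    rw [lazyWalk_sub_const] at contraction
    rw [pow_succ', Module.End.mul_apply]
    refine contraction.trans
      ((mul_le_mul_of_nonneg_left ih (Real.exp_pos _).le).trans_eq ?_)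
    rw [← Real.exp_add]; push_cast; ring_nf

lemma HasSpectralGap.sum_abs_lazyWalk_pow_sub_le (hsymm : ∀ i j, W i j = W j i)
    (hnonneg : ∀ i j, 0 ≤ W i j) {D Λ : ℝ} (hD : 0 < D) (hΛ : 0 < Λ)
    (hdeg : ∀ i, ∑ j, W i j ≤ D) (hgap : HasSpectralGap W Λ) (i : V) {T : ℕ}
    (hT : 4 * D / Λ * Real.log (2 * Fintype.card V) ≤ T) :
    ∑ j, |(lazyWalk W D ^ T) (Pi.single i 1) j - 1 / Fintype.card V| ≤ 1 / 2 := by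
  have : Nonempty V := ⟨i⟩
  have hn : (1 : ℝ) ≤ Fintype.card V := by exact_mod_cast Fintype.card_pos
  have hexp : Real.exp (-(Λ / (2 * D) * T)) ≤ 1 / (2 * Fintype.card V) ^ 2 := by
    have hmix : 2 * Real.log (2 * Fintype.card V) ≤ Λ / (2 * D) * T := by
      refine le_trans (le_of_eq ?_) (mul_le_mul_of_nonneg_left hT (by positivity))
      field
    calc Real.exp (-(Λ / (2 * D) * T)) ≤ Real.exp (-(2 * Real.log (2 * Fintype.card V))) := by
          gcongr
      _ = 1 / (2 * Fintype.card V) ^ 2 := by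
          rw [Real.exp_neg, two_mul (Real.log _), Real.exp_add, Real.exp_log (by positivity),
            one_div, sq]
  refine le_of_sq_le_sq ?_ (by norm_num)
  calc (∑ j, |(lazyWalk W D ^ T) (Pi.single i 1) j - 1 / Fintype.card V|) ^ 2
      ≤ Fintype.card V * ∑ j, ((lazyWalk W D ^ T) (Pi.single i 1) j - 1 / Fintype.card V) ^ 2 := by
        simpa only [sq_abs, Finset.card_univ] using sq_sum_le_card_mul_sum_sq (s := Finset.univ)
          (f := fun j => |(lazyWalk W D ^ T) (Pi.single i 1) j - 1 / Fintype.card V|)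
    _ ≤ Fintype.card V * (1 / (2 * Fintype.card V) ^ 2) := by
        gcongr
        exact (hgap.sum_sq_lazyWalk_pow_sub_le hsymm hnonneg hD hdeg i T).trans hexp
    _ = 1 / 4 / Fintype.card V := by field
    _ ≤ (1 / 2) ^ 2 := by
        rw [div_le_iff₀ (by positivity)]; linarith

lemma truncatedGreen_single_apply (W : V → V → ℝ) (D : ℝ) (T : ℕ) (i j : V) :
    truncatedGreen W D T (Pi.single i 1) j =
      (2 * D)⁻¹ * ∑ t ∈ Finset.range T, (lazyWalk W D ^ t) (Pi.single i 1) j := by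
  simp [truncatedGreen, LinearMap.sum_apply]

lemma sum_truncatedGreen_single (hsymm : ∀ i j, W i j = W j i) (D : ℝ) (T : ℕ) (i : V) :
    ∑ j, truncatedGreen W D T (Pi.single i 1) j = T / (2 * D) := by
  simp only [truncatedGreen_single_apply, ← Finset.mul_sum]
  rw [Finset.sum_comm]
  simp [sum_lazyWalk_pow_single hsymm, div_eq_inv_mul]

lemma truncatedGreen_single_nonneg (hnonneg : ∀ i j, 0 ≤ W i j) {D : ℝ} (hD : 0 < D)
    (hdeg : ∀ i, ∑ j, W i j ≤ D) (T : ℕ) (i j : V) :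
    0 ≤ truncatedGreen W D T (Pi.single i 1) j := by
  rw [truncatedGreen_single_apply]
  exact mul_nonneg (by positivity)
    (Finset.sum_nonneg fun t _ => lazyWalk_pow_single_nonneg hnonneg hD hdeg i t j)

lemma HasSpectralGap.energy_truncatedGreen_single_le (hsymm : ∀ i j, W i j = W j i)
    (hnonneg : ∀ i j, 0 ≤ W i j) {D Λ : ℝ} (hD : 0 < D) (hΛ : 0 < Λ)
    (hdeg : ∀ i, ∑ j, W i j ≤ D) (hgap : HasSpectralGap W Λ) (T : ℕ) (i : V) :
    energy W (truncatedGreen W D T (Pi.single i 1)) ≤ 2 / Λ := by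
  refine hgap.energy_le_of_sum_sq_laplacian_le hsymm hnonneg hΛ ?_
  rw [laplacian_truncatedGreen W hD.ne']
  set π := (lazyWalk W D ^ T) (Pi.single i 1)
  have hπ : ∀ j, 0 ≤ π j := lazyWalk_pow_single_nonneg hnonneg hD hdeg i T
  have hπ_sum : ∑ j, π j = 1 := sum_lazyWalk_pow_single hsymm D i T
  calc ∑ j, (Pi.single i 1 - π : V → ℝ) j ^ 2 ≤ ∑ j, ((Pi.single i 1 : V → ℝ) j + π j) := by
        refine Finset.sum_le_sum fun j _ => ?_
        have hπ_le : π j ≤ 1 :=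
          hπ_sum ▸ Finset.single_le_sum (fun j _ => hπ j) (Finset.mem_univ j)
        rw [Pi.sub_apply, Pi.single_apply]
        split_ifs <;> nlinarith [hπ j]
    _ = 2 := by rw [Finset.sum_add_distrib, hπ_sum]; norm_num

lemma sq_totalVariation_truncatedGreen_single_le (hsymm : ∀ i j, W i j = W j i)
    (hnonneg : ∀ i j, 0 ≤ W i j) {D : ℝ} (hD : 0 < D) (hdeg : ∀ i, ∑ j, W i j ≤ D) (T : ℕ)
    (i : V) {c : ℝ} (hc : 0 < c) :
    totalVariation W (truncatedGreen W D T (Pi.single i 1)) ^ 2 ≤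
      (2 * Real.log ((T / (2 * D) + c) / c)) *
        (2 * D * (T / (2 * D) + Fintype.card V * c)) := by
  rw [← sum_truncatedGreen_single hsymm D T i]
  exact sq_totalVariation_le hsymm hnonneg hdeg (truncatedGreen_single_nonneg hnonneg hD hdeg T i)
    (lazyWalk_pow_single_nonneg hnonneg hD hdeg i T) (sum_lazyWalk_pow_single hsymm D i T)
    (laplacian_truncatedGreen W hD.ne' T _) hc

lemma log_three_mul_log_mul_add_one_le {n : ℝ} (hn : 2 ≤ n) :
    Real.log (3 * Real.log (2 * n) * n + 1) ≤ 3 * Real.log (2 * n) := by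
  have hlog : Real.log (2 * n) ≤ 2 * n := (Real.log_le_sub_one_of_pos (by linarith)).trans (by simp)
  have hlog_nonneg : 0 ≤ Real.log (2 * n) := Real.log_nonneg (by linarith)
  calc Real.log (3 * Real.log (2 * n) * n + 1) ≤ Real.log ((2 * n) ^ 3) := by
        apply Real.log_le_log (by positivity)
        have hn_sq : 4 ≤ n ^ 2 := by nlinarith
        nlinarith [mul_le_mul_of_nonneg_right hlog (by linarith : 0 ≤ n)]
    _ = 3 * Real.log (2 * n) := by rw [Real.log_pow]; norm_num

/-- `u` solves the Poisson equation `laplacian W u = δ_i - 1 / card V` up to an error of `ℓ¹` norm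
at most `1 / 2`. The two bounds on `u` control, respectively, Gaussian-type and worst-case
errors when a function is tested against `u`. -/
structure IsApproxGreen (W : V → V → ℝ) (i : V) (E B : ℝ) (u : V → ℝ) : Prop where
  sum_abs_residual_le :
    ∑ j, |laplacian W u j - ((Pi.single i 1 : V → ℝ) j - 1 / Fintype.card V)| ≤ 1 / 2
  energy_le : energy W u ≤ E
  totalVariation_le : totalVariation W u ≤ B

lemma one_le_log_two_mul {n : ℝ} (hn : 2 ≤ n) : 1 ≤ Real.log (2 * n) := by
  rw [Real.le_log_iff_exp_le (by linarith)]
  linarith [Real.exp_one_lt_d9]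

lemma log_two_mul_le {n : ℝ} (hn : 2 ≤ n) : Real.log (2 * n) ≤ 2 * Real.log n := by
  rw [Real.log_mul two_ne_zero (by linarith)]
  linarith [Real.log_le_log two_pos hn]

/- The entropy bound is applied with the shift `1 / (card V * Λ)`, which contributes `1 / Λ` to the
mass. -/
lemma totalVariation_truncatedGreen_single_le (hsymm : ∀ i j, W i j = W j i)
    (hnonneg : ∀ i j, 0 ≤ W i j) {D Λ : ℝ} (hD : 0 < D) (hΛ : 0 < Λ)
    (hdeg : ∀ i, ∑ j, W i j ≤ D) (hcard : 2 ≤ Fintype.card V) {T : ℕ}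
    (hT : T / (2 * D) ≤ 3 * Real.log (2 * Fintype.card V) / Λ) (i : V) :
    totalVariation W (truncatedGreen W D T (Pi.single i 1)) ≤
      14 * Real.log (Fintype.card V) * √(D / Λ) := by
  set n : ℝ := (Fintype.card V : ℝ) with hn_def
  have hn : 2 ≤ n := by rw [hn_def]; exact_mod_cast hcard
  set m := Real.log (2 * n)
  have hm : 1 ≤ m := one_le_log_two_mul hn
  have hc : 0 < 1 / (n * Λ) := by positivity
  have hlog : Real.log ((T / (2 * D) + 1 / (n * Λ)) / (1 / (n * Λ))) ≤ 3 * m := by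
    refine le_trans (Real.log_le_log (by positivity) ?_) (log_three_mul_log_mul_add_one_le hn)
    calc (T / (2 * D) + 1 / (n * Λ)) / (1 / (n * Λ))
        ≤ (3 * m / Λ + 1 / (n * Λ)) / (1 / (n * Λ)) := by gcongr
      _ = 3 * m * n + 1 := by field
  have hmass : T / (2 * D) + n * (1 / (n * Λ)) ≤ 4 * m / Λ := by
    calc T / (2 * D) + n * (1 / (n * Λ)) ≤ 3 * m / Λ + m / Λ := by
          gcongr; rw [show n * (1 / (n * Λ)) = 1 / Λ by field]; gcongr
      _ = 4 * m / Λ := by ring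
  refine le_of_sq_le_sq ?_ (by positivity)
  calc totalVariation W (truncatedGreen W D T (Pi.single i 1)) ^ 2
      ≤ (2 * (3 * m)) * (2 * D * (4 * m / Λ)) :=
        (sq_totalVariation_truncatedGreen_single_le hsymm hnonneg hD hdeg T i hc).trans
          (by gcongr)
    _ = 48 * m ^ 2 * (D / Λ) := by ring
    _ ≤ 49 * (2 * Real.log n) ^ 2 * (D / Λ) := by
        gcongr
        · norm_num
        · exact log_two_mul_le hn
    _ = (14 * Real.log n * √(D / Λ)) ^ 2 := by
        rw [mul_pow _ √_, Real.sq_sqrt (by positivity)]; ring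

/- The walk is run for twice the `ℓ²` relaxation time `(2 * D / Λ) * log (2 * card V)`. -/
theorem HasSpectralGap.exists_isApproxGreen [Nontrivial V] (hsymm : ∀ i j, W i j = W j i)
    (hnonneg : ∀ i j, 0 ≤ W i j) {D Λ : ℝ} (hΛ : 0 < Λ) (hdeg : ∀ i, ∑ j, W i j ≤ D)
    (hgap : HasSpectralGap W Λ) (i : V) :
    ∃ u, IsApproxGreen W i (2 / Λ) (14 * Real.log (Fintype.card V) * √(D / Λ)) u := by
  have hΛD : Λ ≤ 2 * D := hgap.le_two_mul_degree hsymm hnonneg hdeg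
  have hD : 0 < D := by linarith
  have hcard : 2 ≤ Fintype.card V := Fintype.one_lt_card
  set m := Real.log (2 * Fintype.card V)
  have hm : 1 ≤ m := one_le_log_two_mul (by exact_mod_cast hcard)
  set T := ⌈4 * D / Λ * m⌉₊
  have hmass : (T : ℝ) / (2 * D) ≤ 3 * m / Λ := by
    have hone : 1 ≤ 2 * D / Λ * m := one_le_mul_of_one_le_of_one_le ((one_le_div hΛ).mpr hΛD) hm
    rw [div_le_iff₀ (by positivity)]
    calc (T : ℝ) ≤ 4 * D / Λ * m + 1 := (Nat.ceil_lt_add_one (by positivity)).le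
      _ ≤ 4 * D / Λ * m + 2 * D / Λ * m := by gcongr
      _ = 3 * m / Λ * (2 * D) := by ring
  refine ⟨truncatedGreen W D T (Pi.single i 1), ?_,
    hgap.energy_truncatedGreen_single_le hsymm hnonneg hD hΛ hdeg T i,
    totalVariation_truncatedGreen_single_le hsymm hnonneg hD hΛ hdeg hcard hmass i⟩
  refine le_trans (le_of_eq (Finset.sum_congr rfl fun j _ => ?_))
    (hgap.sum_abs_lazyWalk_pow_sub_le hsymm hnonneg hD hΛ hdeg i (Nat.le_ceil (4 * D / Λ * m)))
  rw [laplacian_truncatedGreen W hD.ne', Pi.sub_apply, sub_sub_sub_cancel_left, abs_sub_comm]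

lemma IsApproxGreen.abs_apply_le {i : V} {E B : ℝ} {u x : V → ℝ} (hu : IsApproxGreen W i E B u)
    (hx : ∑ j, x j = 0) (hmax : ∀ j, |x j| ≤ |x i|) :
    |x i| ≤ 2 * |∑ j, x j * laplacian W u j| := by
  set r : V → ℝ := fun j =>
    laplacian W u j - ((Pi.single i 1 : V → ℝ) j - 1 / Fintype.card V) with hr
  have hsum : ∑ j, x j * laplacian W u j = x i + ∑ j, x j * r j := by
    simp [hr, mul_sub, Finset.sum_sub_distrib, ← Finset.sum_mul, hx, Pi.single_apply]
  have hresidual : |∑ j, x j * r j| ≤ |x i| * (1 / 2) :=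
    calc |∑ j, x j * r j| ≤ ∑ j, |x i| * |r j| := by
          refine (Finset.abs_sum_le_sum_abs _ _).trans (Finset.sum_le_sum fun j _ => ?_)
          rw [abs_mul]
          exact mul_le_mul_of_nonneg_right (hmax j) (abs_nonneg _)
      _ ≤ |x i| * (1 / 2) := by
          rw [← Finset.mul_sum]
          gcongr
          exact hu.sum_abs_residual_le
  have htriangle := abs_sub_abs_le_abs_add (x i) (∑ j, x j * r j)
  rw [hsum]
  linarith

end GreenFunction

section SpectralGap

variable {V : Type*} [Fintype V] {W : V → V → ℝ}

/-- Edge expansion for small sets, in a form suited to functions that drop by a factor of two: for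
`A ⊆ D` with `D` of size at most half of `V` and comparable to `A`, the weight of the edges from `A`
to the complement of `D` is at least `c` times the size of `A`. -/
def HasSmallSetExpansion [DecidableEq V] (W : V → V → ℝ) (c : ℝ) : Prop :=
  ∀ A D : Finset V, A ⊆ D → 2 * #D ≤ Fintype.card V → #D ≤ 8 * #A →
    c * #A ≤ ∑ a ∈ A, ∑ b ∈ Dᶜ, W a b

lemma HasSmallSetExpansion.superlevel_le [DecidableEq V] (hnonneg : ∀ i j, 0 ≤ W i j) {c : ℝ}
    (hc : 0 ≤ c) (hexp : HasSmallSetExpansion W c) {y : V → ℝ}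
    (hsupp : 2 * #{i | 0 < y i} ≤ Fintype.card V) {t : ℝ} (ht : 0 < t) :
    c * #{a | t ≤ y a / 2} - c / 8 * #{a | t ≤ y a} ≤
      ∑ a with t ≤ y a / 2, ∑ b with y b < t, W a b := by
  set A : Finset V := {a | t ≤ y a / 2}
  set D : Finset V := {a | t ≤ y a}
  have hcompl : Finset.univ.filter (fun b => y b < t) = Dᶜ := by ext b; simp [D]
  rw [hcompl]
  rcases le_or_gt #D (8 * #A) with hcard | hcard
  · have hAD : A ⊆ D := Finset.monotone_filter_right _ fun a _ ha => by linarith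
    have hD : 2 * #D ≤ Fintype.card V := le_trans (Nat.mul_le_mul_left 2 (Finset.card_le_card
      (Finset.monotone_filter_right _ fun a _ ha => ht.trans_le ha))) hsupp
    exact (sub_le_self _ (by positivity)).trans (hexp A D hAD hD hcard)
  · have hcut : 0 ≤ ∑ a ∈ A, ∑ b ∈ Dᶜ, W a b :=
      Finset.sum_nonneg fun a _ => Finset.sum_nonneg fun b _ => hnonneg a b
    have hcard' : 8 * (#A : ℝ) ≤ #D := by exact_mod_cast hcard.le
    nlinarith

lemma integrable_indicator_Ioc_id (a b : ℝ) : Integrable ((Set.Ioc a b).indicator id) :=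
  continuous_id.integrableOn_Ioc.integrable_indicator measurableSet_Ioc

lemma integral_indicator_Ioc_id {a b : ℝ} (h : a ≤ b) :
    ∫ t, (Set.Ioc a b).indicator id t = (b ^ 2 - a ^ 2) / 2 := by
  rw [integral_indicator measurableSet_Ioc, ← intervalIntegral.integral_of_le h]
  simp [integral_id]

lemma integral_indicator_Ioc_half_le {y z : ℝ} (hy : 0 ≤ y) :
    ∫ t, (Set.Ioc z (y / 2)).indicator id t ≤ (y - z)⁺ ^ 2 / 2 := by
  rcases le_total z (y / 2) with h | h
  · rw [integral_indicator_Ioc_id h, posPart_of_nonneg (by linarith)]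
    nlinarith
  · rw [Set.Ioc_eq_empty (by linarith)]
    simp only [Set.indicator_empty, integral_zero]
    positivity

lemma sum_indicator_Ioc_id (f g : V → ℝ) {t : ℝ} :
    ∑ a, (Set.Ioc (f a) (g a)).indicator id t = t * #{a | f a < t ∧ t ≤ g a} := by
  simp only [Set.indicator_apply, Set.mem_Ioc, id, ← Finset.sum_filter, Finset.sum_const,
    nsmul_eq_mul, mul_comm]

lemma HasSmallSetExpansion.sum_indicator_le [DecidableEq V] (hnonneg : ∀ i j, 0 ≤ W i j) {c : ℝ}
    (hc : 0 ≤ c) (hexp : HasSmallSetExpansion W c) {y : V → ℝ} (hy : ∀ i, 0 ≤ y i)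
    (hsupp : 2 * #{i | 0 < y i} ≤ Fintype.card V) (t : ℝ) :
    ∑ a, (c * (Set.Ioc 0 (y a / 2)).indicator id t - c / 8 * (Set.Ioc 0 (y a)).indicator id t) ≤
      ∑ a, ∑ b, W a b * (Set.Ioc (y b) (y a / 2)).indicator id t := by
  rcases le_or_gt t 0 with ht | ht
  · have vanish {a b : ℝ} (ha : 0 ≤ a) : (Set.Ioc a b).indicator (id : ℝ → ℝ) t = 0 :=
      Set.indicator_of_notMem (fun h => (ht.trans ha).not_gt h.1) _
    simp [vanish le_rfl, vanish (hy _)]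
  · have hcut : ∑ a, ∑ b, W a b * (Set.Ioc (y b) (y a / 2)).indicator id t =
        t * ∑ a with t ≤ y a / 2, ∑ b with y b < t, W a b := by
      simp only [Finset.mul_sum, Finset.sum_filter, Set.indicator_apply, Set.mem_Ioc, id]
      refine Finset.sum_congr rfl fun a _ => ?_
      by_cases ha : t ≤ y a / 2
      · simp only [ha, and_true, if_true, Finset.mul_sum, mul_ite, mul_zero, mul_comm]
      · simp [ha]
    rw [hcut, Finset.sum_sub_distrib, ← Finset.mul_sum, ← Finset.mul_sum, sum_indicator_Ioc_id,
      sum_indicator_Ioc_id]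
    simp only [ht, true_and]
    linarith [mul_le_mul_of_nonneg_left (hexp.superlevel_le hnonneg hc hsupp ht) ht.le]

lemma sq_posPart_add_sq_negPart (t : ℝ) : t⁺ ^ 2 + t⁻ ^ 2 = t ^ 2 := by
  rcases le_total 0 t with h | h
  · rw [posPart_of_nonneg h, negPart_of_nonneg h]; ring
  · rw [posPart_of_nonpos h, negPart_of_nonpos h]; ring

lemma sum_mul_sq_posPart_sub_eq_energy (hsymm : ∀ i j, W i j = W j i) (y : V → ℝ) :
    ∑ a, ∑ b, W a b * (y a - y b)⁺ ^ 2 = energy W y := by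
  have swap : ∑ a, ∑ b, W a b * (y a - y b)⁺ ^ 2 = ∑ a, ∑ b, W a b * (y a - y b)⁻ ^ 2 := by
    rw [Finset.sum_comm]
    refine Finset.sum_congr rfl fun a _ => Finset.sum_congr rfl fun b _ => ?_
    rw [hsymm b a, ← neg_sub (y a), posPart_neg]
  have split : ∑ a, ∑ b, W a b * (y a - y b) ^ 2 =
      ∑ a, ∑ b, W a b * (y a - y b)⁺ ^ 2 + ∑ a, ∑ b, W a b * (y a - y b)⁻ ^ 2 := by
    simp only [← Finset.sum_add_distrib, ← mul_add]
    simp only [sq_posPart_add_sq_negPart]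
  rw [energy, split, ← swap]
  ring

/- Multi-scale Cheeger bound: integrate the expansion of the superlevel sets `{t ≤ y / 2}` inside
`{t ≤ y}` against `t dt`. No Cauchy–Schwarz step is needed, so the expansion is not squared. -/
lemma HasSmallSetExpansion.energy_ge_of_small_support [DecidableEq V]
    (hsymm : ∀ i j, W i j = W j i) (hnonneg : ∀ i j, 0 ≤ W i j) {c : ℝ} (hc : 0 ≤ c)
    (hexp : HasSmallSetExpansion W c) {y : V → ℝ} (hy : ∀ i, 0 ≤ y i)
    (hsupp : 2 * #{i | 0 < y i} ≤ Fintype.card V) :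
    c / 8 * ∑ i, y i ^ 2 ≤ energy W y := by
  have hint_left (a : V) : Integrable fun t => c * (Set.Ioc 0 (y a / 2)).indicator id t -
      c / 8 * (Set.Ioc 0 (y a)).indicator id t :=
    ((integrable_indicator_Ioc_id _ _).const_mul _).sub
      ((integrable_indicator_Ioc_id _ _).const_mul _)
  have hint_right (a b : V) :
      Integrable fun t => W a b * (Set.Ioc (y b) (y a / 2)).indicator id t :=
    (integrable_indicator_Ioc_id _ _).const_mul _
  have hleft (a : V) : ∫ t, (c * (Set.Ioc 0 (y a / 2)).indicator id t -
      c / 8 * (Set.Ioc 0 (y a)).indicator id t) = c / 16 * y a ^ 2 := by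
    rw [integral_sub ((integrable_indicator_Ioc_id _ _).const_mul _)
      ((integrable_indicator_Ioc_id _ _).const_mul _), integral_const_mul, integral_const_mul,
      integral_indicator_Ioc_id (by linarith [hy a]), integral_indicator_Ioc_id (hy a)]
    ring
  have hright (a b : V) : ∫ t, W a b * (Set.Ioc (y b) (y a / 2)).indicator id t ≤
      W a b * ((y a - y b)⁺ ^ 2 / 2) := by
    rw [integral_const_mul]
    exact mul_le_mul_of_nonneg_left (integral_indicator_Ioc_half_le (hy a)) (hnonneg a b)
  have hlevel := integral_mono (integrable_finsetSum _ fun a _ => hint_left a)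
    (integrable_finsetSum _ fun a _ => integrable_finsetSum _ fun b _ => hint_right a b)
    (hexp.sum_indicator_le hnonneg hc hy hsupp)
  rw [integral_finsetSum _ fun a _ => hint_left a,
    integral_finsetSum _ fun a _ => integrable_finsetSum _ fun b _ => hint_right a b] at hlevel
  simp only [integral_finsetSum _ fun b _ => hint_right _ b, hleft] at hlevel
  calc c / 8 * ∑ i, y i ^ 2 = 2 * ∑ i, c / 16 * y i ^ 2 := by rw [← Finset.mul_sum]; ring
    _ ≤ 2 * ∑ a, ∑ b, W a b * ((y a - y b)⁺ ^ 2 / 2) := by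
        refine mul_le_mul_of_nonneg_left ?_ zero_le_two
        exact hlevel.trans (Finset.sum_le_sum fun a _ => Finset.sum_le_sum fun b _ => hright a b)
    _ = energy W y := by
        rw [← sum_mul_sq_posPart_sub_eq_energy hsymm]
        simp only [Finset.mul_sum]
        exact Finset.sum_congr rfl fun a _ => Finset.sum_congr rfl fun b _ => by ring

lemma exists_median (x : V → ℝ) :
    ∃ m : ℝ, 2 * #{i | m < x i} ≤ Fintype.card V ∧ 2 * #{i | x i < m} ≤ Fintype.card V := by
  rcases isEmpty_or_nonempty V with _ | _
  · exact ⟨0, by simp⟩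
  let S : Finset V := {i | 2 * #{j | x i < x j} ≤ Fintype.card V}
  have hS : S.Nonempty := by
    obtain ⟨i, hi⟩ := Finite.exists_max x
    exact ⟨i, by simp [S, Finset.filter_false_of_mem fun j _ => not_lt.mpr (hi j)]⟩
  obtain ⟨i, hiS, hi⟩ := S.exists_min_image x hS
  refine ⟨x i, (Finset.mem_filter.mp hiS).2, ?_⟩
  rcases (Finset.univ.filter fun j => x j < x i).eq_empty_or_nonempty with hempty | hne
  · simp [hempty]
  obtain ⟨j, hj, hj_max⟩ := Finset.exists_max_image _ x hne
  have hjS : Fintype.card V < 2 * #{k | x j < x k} := by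
    have : j ∉ S := fun hjS => (hi j hjS).not_gt (Finset.mem_filter.mp hj).2
    simpa [S] using this
  have hdisj : Disjoint (Finset.univ.filter fun k => x k < x i)
      (Finset.univ.filter fun k => x j < x k) :=
    Finset.disjoint_left.mpr fun k hk hk' => (hj_max k hk).not_gt (Finset.mem_filter.mp hk').2
  have hcard := Finset.card_le_univ (Finset.disjUnion _ _ hdisj)
  rw [Finset.card_disjUnion] at hcard
  omega

lemma energy_posPart_add_energy_negPart_le (hnonneg : ∀ i j, 0 ≤ W i j) (x : V → ℝ) :
    energy W x⁺ + energy W x⁻ ≤ energy W x := by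
  simp only [energy, ← mul_add, ← Finset.sum_add_distrib]
  gcongr with i _ j _
  · exact hnonneg i j
  · simp only [Pi.posPart_apply, Pi.negPart_apply]
    rcases le_total 0 (x i) with hi | hi <;> rcases le_total 0 (x j) with hj | hj <;>
      simp only [hi, hj, posPart_of_nonneg, negPart_of_nonneg, posPart_of_nonpos,
        negPart_of_nonpos] <;> nlinarith

/- Subtract a median and apply the small-support bound to the positive and negative parts. -/
theorem HasSmallSetExpansion.hasSpectralGap [DecidableEq V] (hsymm : ∀ i j, W i j = W j i)
    (hnonneg : ∀ i j, 0 ≤ W i j) {c : ℝ} (hc : 0 ≤ c) (hexp : HasSmallSetExpansion W c) :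
    HasSpectralGap W (c / 8) := by
  intro x hx
  obtain ⟨m, hm_above, hm_below⟩ := exists_median x
  let y : V → ℝ := fun i => x i - m
  have hpos : c / 8 * ∑ i, y⁺ i ^ 2 ≤ energy W y⁺ :=
    hexp.energy_ge_of_small_support hsymm hnonneg hc (fun i => posPart_nonneg _)
      (by simpa [y, posPart_pos_iff] using hm_above)
  have hneg : c / 8 * ∑ i, y⁻ i ^ 2 ≤ energy W y⁻ :=
    hexp.energy_ge_of_small_support hsymm hnonneg hc (fun i => negPart_nonneg _)
      (by simpa [y, negPart_pos_iff] using hm_below)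
  have hsplit : ∑ i, y i ^ 2 = ∑ i, y⁺ i ^ 2 + ∑ i, y⁻ i ^ 2 := by
    simp only [← Finset.sum_add_distrib, Pi.posPart_apply, Pi.negPart_apply,
      sq_posPart_add_sq_negPart]
  have hvariance : ∑ i, x i ^ 2 ≤ ∑ i, y i ^ 2 := by
    have : ∑ i, y i ^ 2 = ∑ i, x i ^ 2 + Fintype.card V * m ^ 2 := by
      simp only [y, sub_sq, Finset.sum_add_distrib, Finset.sum_sub_distrib, ← Finset.sum_mul,
        ← Finset.mul_sum, hx]
      simp
    rw [this]
    exact le_add_of_nonneg_right (by positivity)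
  calc c / 8 * ∑ i, x i ^ 2 ≤ c / 8 * ∑ i, y i ^ 2 := by gcongr
    _ ≤ energy W y⁺ + energy W y⁻ := by rw [hsplit, mul_add]; exact add_le_add hpos hneg
    _ ≤ energy W y := energy_posPart_add_energy_negPart_le hnonneg y
    _ = energy W x := energy_sub_const W x m

end SpectralGap

section Sigmoid

lemma winProb_eq_sigmoid {n : ℕ} (θ : Fin n → ℝ) (a b : Fin n) :
    winProb θ a b = Real.sigmoid (θ a - θ b) := by
  rw [winProb, Real.sigmoid_def, neg_sub, Real.exp_sub]
  field

/-- The derivative of the sigmoid function at `z`, which is also the Fisher information of one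
comparison between items whose scores differ by `z`. -/
def sigmoidDeriv (z : ℝ) : ℝ := Real.sigmoid z * (1 - Real.sigmoid z)

lemma sigmoidDeriv_pos (z : ℝ) : 0 < sigmoidDeriv z :=
  mul_pos (Real.sigmoid_pos z) (sub_pos.mpr (Real.sigmoid_lt_one z))

lemma sigmoidDeriv_le_one (z : ℝ) : sigmoidDeriv z ≤ 1 :=
  mul_le_one₀ (Real.sigmoid_lt_one z).le (sub_pos.mpr (Real.sigmoid_lt_one z)).le
    (sub_le_self _ (Real.sigmoid_pos z).le)

lemma sigmoidDeriv_abs (z : ℝ) : sigmoidDeriv |z| = sigmoidDeriv z := by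
  rcases abs_choice z with h | h <;> rw [h]
  simp only [sigmoidDeriv, Real.sigmoid_neg]
  ring

lemma one_sub_sigmoid (z : ℝ) : 1 - Real.sigmoid z = Real.sigmoid z * Real.exp (-z) := by
  rw [Real.sigmoid_mul_rexp_neg, Real.sigmoid_neg]

lemma inv_four_mul_exp_le_sigmoidDeriv {z b : ℝ} (hz : |z| ≤ b) :
    1 / (4 * Real.exp b) ≤ sigmoidDeriv z := by
  have half_le : 1 / 2 ≤ Real.sigmoid |z| := by
    simpa [Real.sigmoid_zero] using Real.sigmoid_le (abs_nonneg z)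
  calc 1 / (4 * Real.exp b) = 1 / 2 * (1 / 2 * Real.exp (-b)) := by rw [Real.exp_neg]; field
    _ ≤ Real.sigmoid |z| * (Real.sigmoid |z| * Real.exp (-|z|)) := by gcongr
    _ = sigmoidDeriv z := by rw [← one_sub_sigmoid, ← sigmoidDeriv_abs, sigmoidDeriv]

lemma sigmoid_add (z h : ℝ) :
    Real.sigmoid (z + h) =
      Real.sigmoid z * Real.exp h / (1 + Real.sigmoid z * (Real.exp h - 1)) := by
  have hden : 1 + Real.sigmoid z * (Real.exp h - 1) =
      Real.sigmoid z * Real.exp h + (1 - Real.sigmoid z) := by ring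
  rw [hden, one_sub_sigmoid, Real.sigmoid_def, Real.sigmoid_def, neg_add, Real.exp_add,
    Real.exp_neg h]
  field

/- Self-concordance: the Taylor remainder is bounded by the derivative itself. -/
lemma abs_sigmoid_taylor_le {z h : ℝ} (hh : |h| ≤ 1) :
    |Real.sigmoid (z + h) - Real.sigmoid z - sigmoidDeriv z * h| ≤
      9 * sigmoidDeriv z * h ^ 2 := by
  set s := Real.sigmoid z with hs
  have hs_pos : 0 < s := Real.sigmoid_pos z
  have hs_lt : s < 1 := Real.sigmoid_lt_one z
  set m := Real.exp h - 1 with hm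
  have hden : 1 / 3 ≤ 1 + s * m := by
    have hexp : 1 / 3 ≤ Real.exp h := by
      calc (1 : ℝ) / 3 ≤ 1 / Real.exp 1 := by gcongr; linarith [Real.exp_one_lt_d9]
        _ = Real.exp (-1) := by rw [Real.exp_neg, one_div]
        _ ≤ Real.exp h := Real.exp_le_exp.mpr (abs_le.mp hh).1
    nlinarith
  have hrem : Real.sigmoid (z + h) - s - sigmoidDeriv z * h =
      sigmoidDeriv z * ((m - h - s * m * h) / (1 + s * m)) := by
    have : 1 + s * m ≠ 0 := by linarith
    rw [sigmoid_add, sigmoidDeriv, ← hs, ← hm, show Real.exp h = m + 1 by rw [hm]; ring]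
    field
  have hnum : |m - h - s * m * h| ≤ 3 * h ^ 2 := by
    calc |m - h - s * m * h| ≤ |m - h| + |s * m * h| := abs_sub _ _
      _ = |Real.exp h - 1 - h| + s * |Real.exp h - 1| * |h| := by
          rw [abs_mul, abs_mul, abs_of_pos hs_pos]
      _ ≤ h ^ 2 + 1 * (2 * |h|) * |h| := by
          gcongr
          · exact Real.abs_exp_sub_one_sub_id_le hh
          · exact Real.abs_exp_sub_one_le hh
      _ = 3 * h ^ 2 := by rw [← sq_abs h]; ring
  have hquot : |m - h - s * m * h| / (1 + s * m) ≤ 9 * h ^ 2 := by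
    rw [div_le_iff₀ (by linarith)]
    nlinarith [sq_nonneg h]
  rw [hrem, abs_mul, abs_of_pos (sigmoidDeriv_pos z), abs_div,
    abs_of_pos (by linarith : 0 < 1 + s * m)]
  calc sigmoidDeriv z * (|m - h - s * m * h| / (1 + s * m))
      ≤ sigmoidDeriv z * (9 * h ^ 2) :=
        mul_le_mul_of_nonneg_left hquot (sigmoidDeriv_pos z).le
    _ = 9 * sigmoidDeriv z * h ^ 2 := by ring

/-- The negative log-likelihood of one comparison as a function of the score difference `z`; the
outcome `true` has probability `Real.sigmoid z`. -/
def logisticLoss (b : Bool) (z : ℝ) : ℝ :=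
  -Real.log (if b then Real.sigmoid z else Real.sigmoid (-z))

lemma logisticLoss_false (z : ℝ) : logisticLoss false z = logisticLoss true (-z) := by
  simp [logisticLoss]

lemma continuous_logisticLoss (b : Bool) : Continuous (logisticLoss b) := by
  have htrue : Continuous (logisticLoss true) :=
    (continuous_sigmoid.log fun z => (Real.sigmoid_pos z).ne').neg
  cases b with
  | true => exact htrue
  | false => exact (htrue.comp continuous_neg).congr fun z => (logisticLoss_false z).symm

lemma logisticLoss_true_tangent_lt {z z' : ℝ} (h : z ≠ z') :
    logisticLoss true z + (Real.sigmoid z - 1) * (z' - z) < logisticLoss true z' := by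
  have hs_pos : 0 < Real.sigmoid z := Real.sigmoid_pos z
  have hratio : Real.sigmoid z / Real.sigmoid z' =
      Real.sigmoid z + (1 - Real.sigmoid z) * Real.exp (-(z' - z)) := by
    rw [one_sub_sigmoid, Real.sigmoid_def z', div_inv_eq_mul, mul_assoc, ← Real.exp_add,
      show -z + -(z' - z) = -z' by ring]
    ring
  have hconvex : Real.exp ((1 - Real.sigmoid z) * -(z' - z)) <
      Real.sigmoid z / Real.sigmoid z' := by
    have := strictConvexOn_exp.2 (Set.mem_univ 0) (Set.mem_univ (-(z' - z)))
      (by contrapose! h; linarith) hs_pos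
      (sub_pos.mpr (Real.sigmoid_lt_one z)) (add_sub_cancel _ _)
    simpa only [hratio, smul_eq_mul, mul_zero, zero_add, Real.exp_zero, mul_one] using this
  have hlog := Real.log_lt_log (Real.exp_pos _) hconvex
  rw [Real.log_exp, Real.log_div hs_pos.ne' (Real.sigmoid_pos z').ne'] at hlog
  simp only [logisticLoss, if_true]
  linarith

lemma logisticLoss_tangent_lt (b : Bool) {z z' : ℝ} (h : z ≠ z') :
    logisticLoss b z + (Real.sigmoid z - if b then 1 else 0) * (z' - z) < logisticLoss b z' := by
  cases b with
  | true => simpa using logisticLoss_true_tangent_lt h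
  | false =>
    have := logisticLoss_true_tangent_lt (neg_injective.ne h)
    rw [Real.sigmoid_neg, ← logisticLoss_false, ← logisticLoss_false] at this
    simp only [Bool.false_eq_true, if_false]
    linarith

lemma logisticLoss_tangent_le (b : Bool) (z z' : ℝ) :
    logisticLoss b z + (Real.sigmoid z - if b then 1 else 0) * (z' - z) ≤ logisticLoss b z' := by
  rcases eq_or_ne z z' with rfl | h
  · simp
  · exact (logisticLoss_tangent_lt b h).le

end Sigmoid

section PairSums

variable {n : ℕ}

/-- The score difference across a pair, positive when the item with the smaller index is ahead. -/
def pairDiff (x : Fin n → ℝ) (e : Pair n) : ℝ := x e.1.2 - x e.1.1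

/-- Weights on pairs as a strictly lower triangular matrix. It is used to reduce sums over pairs to
double sums over items. -/
def lowerWeight (f : Pair n → ℝ) (i j : Fin n) : ℝ := if h : j < i then f ⟨(i, j), h⟩ else 0

/-- Weights on pairs as a symmetric matrix with zero diagonal, the form in which they enter the
Laplacian. -/
def symWeight (f : Pair n → ℝ) (i j : Fin n) : ℝ := lowerWeight f i j + lowerWeight f j i

lemma symWeight_comm (f : Pair n → ℝ) (i j : Fin n) : symWeight f i j = symWeight f j i :=
  add_comm _ _

lemma lowerWeight_nonneg {f : Pair n → ℝ} (hf : ∀ e, 0 ≤ f e) (i j : Fin n) :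
    0 ≤ lowerWeight f i j := by
  unfold lowerWeight
  split_ifs
  exacts [hf _, le_rfl]

lemma symWeight_nonneg {f : Pair n → ℝ} (hf : ∀ e, 0 ≤ f e) (i j : Fin n) :
    0 ≤ symWeight f i j :=
  add_nonneg (lowerWeight_nonneg hf i j) (lowerWeight_nonneg hf j i)

lemma symWeight_mono {f g : Pair n → ℝ} (h : ∀ e, f e ≤ g e) (i j : Fin n) :
    symWeight f i j ≤ symWeight g i j := by
  unfold symWeight lowerWeight
  gcongr <;> split_ifs <;> first | exact h _ | exact le_rfl

lemma sum_lowerWeight_mul (f : Pair n → ℝ) (F : Fin n → Fin n → ℝ) :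
    ∑ i, ∑ j, lowerWeight f i j * F i j = ∑ e : Pair n, f e * F e.1.1 e.1.2 := by
  calc ∑ i, ∑ j, lowerWeight f i j * F i j
      = ∑ e : Fin n × Fin n, lowerWeight f e.1 e.2 * F e.1 e.2 :=
        (Fintype.sum_prod_type' _).symm
    _ = ∑ e : Fin n × Fin n with e.2 < e.1, lowerWeight f e.1 e.2 * F e.1 e.2 := by
        refine (Finset.sum_filter_of_ne fun e _ hne => ?_).symm
        by_contra hlt
        exact hne (by rw [lowerWeight, dif_neg hlt, zero_mul])
    _ = ∑ e : Pair n, lowerWeight f e.1.1 e.1.2 * F e.1.1 e.1.2 :=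
        Finset.sum_subtype _ (by simp) fun e : Fin n × Fin n => lowerWeight f e.1 e.2 * F e.1 e.2
    _ = ∑ e : Pair n, f e * F e.1.1 e.1.2 :=
        Finset.sum_congr rfl fun e _ => by rw [lowerWeight, dif_pos e.2]

lemma sum_symWeight_mul (f : Pair n → ℝ) (F : Fin n → Fin n → ℝ) :
    ∑ i, ∑ j, symWeight f i j * F i j =
      ∑ e : Pair n, f e * (F e.1.1 e.1.2 + F e.1.2 e.1.1) := by
  have swap : ∑ i, ∑ j, lowerWeight f j i * F i j = ∑ i, ∑ j, lowerWeight f i j * F j i :=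
    Finset.sum_comm
  simp only [symWeight, add_mul, mul_add, Finset.sum_add_distrib, swap, sum_lowerWeight_mul,
    sum_lowerWeight_mul f fun i j => F j i]

lemma energy_symWeight (f : Pair n → ℝ) (x : Fin n → ℝ) :
    energy (symWeight f) x = ∑ e, f e * pairDiff x e ^ 2 := by
  rw [energy, sum_symWeight_mul f fun i j => (x i - x j) ^ 2, Finset.mul_sum]
  exact Finset.sum_congr rfl fun e _ => by rw [pairDiff]; ring

lemma totalVariation_symWeight (f : Pair n → ℝ) (x : Fin n → ℝ) :
    totalVariation (symWeight f) x = 2 * ∑ e, f e * |pairDiff x e| := by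
  rw [totalVariation, sum_symWeight_mul f fun i j => |x i - x j|, Finset.mul_sum]
  refine Finset.sum_congr rfl fun e _ => ?_
  rw [pairDiff, abs_sub_comm (x e.1.1)]
  ring

lemma sum_mul_laplacian_symWeight (f : Pair n → ℝ) (x y : Fin n → ℝ) :
    ∑ i, x i * laplacian (symWeight f) y i = ∑ e, f e * (pairDiff x e * pairDiff y e) := by
  rw [sum_mul_laplacian (symWeight_comm f),
    sum_symWeight_mul f fun i j => (x i - x j) * (y i - y j), Finset.mul_sum]
  exact Finset.sum_congr rfl fun e _ => by simp only [pairDiff]; ring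

/-- The divergence of a flow on pairs, where positive flow runs from the larger index to the
smaller one. It is the adjoint of `pairDiff`. -/
def divergence (s : Pair n → ℝ) (i : Fin n) : ℝ :=
  ∑ e : Pair n, s e * ((if e.1.2 = i then 1 else 0) - if e.1.1 = i then 1 else 0)

lemma sum_mul_divergence (s : Pair n → ℝ) (a : Fin n → ℝ) :
    ∑ i, a i * divergence s i = ∑ e : Pair n, s e * pairDiff a e := by
  simp only [divergence, Finset.mul_sum]
  rw [Finset.sum_comm]
  refine Finset.sum_congr rfl fun e _ => ?_
  simp only [mul_sub, Finset.sum_sub_distrib, mul_ite, mul_one, mul_zero, Finset.sum_ite_eq,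
    Finset.mem_univ, if_true, pairDiff]
  ring

lemma sum_divergence (s : Pair n → ℝ) : ∑ i, divergence s i = 0 := by
  simpa [pairDiff] using sum_mul_divergence s fun _ => 1

end PairSums

section WeightedMLE

variable {n L : ℕ} {w : Pair n → ℝ} {θ x z : Fin n → ℝ} {y : Pair n → Fin L → Bool}

/-- The derivative of the weighted loss with respect to the score difference across a pair. -/
def pairScore (w : Pair n → ℝ) (y : Pair n → Fin L → Bool) (x : Fin n → ℝ) (e : Pair n) : ℝ :=
  w e * (1 / L * ∑ l, (Real.sigmoid (pairDiff x e) - if y e l then 1 else 0))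

/-- The second derivative of the weighted loss with respect to the score difference across a pair.
These are the weights of the Laplacian that is the Hessian of the loss. -/
def curvature (w : Pair n → ℝ) (x : Fin n → ℝ) (e : Pair n) : ℝ :=
  w e * sigmoidDeriv (pairDiff x e)

lemma curvature_nonneg (hw : ∀ e, 0 ≤ w e) (x : Fin n → ℝ) (e : Pair n) : 0 ≤ curvature w x e :=
  mul_nonneg (hw e) (sigmoidDeriv_pos _).le

lemma weightedLoss_eq_sum_logisticLoss (w : Pair n → ℝ) (y : Pair n → Fin L → Bool)
    (x : Fin n → ℝ) :
    weightedLoss w y x = ∑ e, ∑ l, 1 / L * (w e * logisticLoss (y e l) (pairDiff x e)) := by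
  simp only [weightedLoss, Finset.mul_sum, winProb_eq_sigmoid]
  refine Finset.sum_congr rfl fun e _ => Finset.sum_congr rfl fun l _ => ?_
  simp only [logisticLoss, pairDiff, neg_sub]
  ring

lemma pairScore_mul (w : Pair n → ℝ) (y : Pair n → Fin L → Bool) (x : Fin n → ℝ) (e : Pair n)
    (h : ℝ) : pairScore w y x e * h =
      ∑ l, 1 / L * (w e * ((Real.sigmoid (pairDiff x e) - if y e l then 1 else 0) * h)) := by
  simp only [pairScore, Finset.mul_sum, Finset.sum_mul]
  exact Finset.sum_congr rfl fun l _ => by ring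

lemma weightedLoss_tangent_le (hw : ∀ e, 0 ≤ w e) (y : Pair n → Fin L → Bool)
    (x x' : Fin n → ℝ) :
    weightedLoss w y x + ∑ e, pairScore w y x e * (pairDiff x' e - pairDiff x e) ≤
      weightedLoss w y x' := by
  simp only [weightedLoss_eq_sum_logisticLoss, pairScore_mul, ← Finset.sum_add_distrib, ← mul_add]
  gcongr with e _ l
  · exact hw e
  · exact logisticLoss_tangent_le (y e l) (pairDiff x e) (pairDiff x' e)

lemma weightedLoss_tangent_lt (hw : ∀ e, 0 ≤ w e) (hL : 0 < L) (y : Pair n → Fin L → Bool)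
    {x x' : Fin n → ℝ} {e : Pair n} (he : 0 < w e) (hne : pairDiff x e ≠ pairDiff x' e) :
    weightedLoss w y x + ∑ e, pairScore w y x e * (pairDiff x' e - pairDiff x e) <
      weightedLoss w y x' := by
  simp only [weightedLoss_eq_sum_logisticLoss, pairScore_mul, ← Finset.sum_add_distrib, ← mul_add]
  have : Nonempty (Fin L) := ⟨⟨0, hL⟩⟩
  refine Finset.sum_lt_sum (fun e _ => ?_)
    ⟨e, Finset.mem_univ e, Finset.sum_lt_sum_of_nonempty Finset.univ_nonempty fun l _ => ?_⟩
  · gcongr with l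
    · exact hw e
    · exact logisticLoss_tangent_le (y e l) (pairDiff x e) (pairDiff x' e)
  · have := logisticLoss_tangent_lt (y e l) hne
    gcongr

lemma continuous_pairDiff (e : Pair n) : Continuous fun x : Fin n → ℝ => pairDiff x e := by
  unfold pairDiff
  fun_prop

lemma continuous_weightedLoss (w : Pair n → ℝ) (y : Pair n → Fin L → Bool) :
    Continuous (weightedLoss w y) := by
  rw [funext (weightedLoss_eq_sum_logisticLoss w y)]
  exact continuous_finsetSum _ fun e _ => continuous_finsetSum _ fun l _ =>
    continuous_const.mul (continuous_const.mul
      ((continuous_logisticLoss _).comp (continuous_pairDiff e)))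

lemma continuous_pairScore (w : Pair n → ℝ) (y : Pair n → Fin L → Bool) (e : Pair n) :
    Continuous fun x => pairScore w y x e :=
  continuous_const.mul (continuous_const.mul (continuous_finsetSum _ fun _ _ =>
    (continuous_sigmoid.comp (continuous_pairDiff e)).sub continuous_const))

lemma pairDiff_sub (x x' : Fin n → ℝ) (e : Pair n) :
    pairDiff (x - x') e = pairDiff x e - pairDiff x' e :=
  sub_sub_sub_comm _ _ _ _

lemma pairDiff_smul (t : ℝ) (x : Fin n → ℝ) (e : Pair n) :
    pairDiff (t • x) e = t * pairDiff x e :=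
  (mul_sub _ _ _).symm

lemma sum_pairScore_mul_nonneg_of_isMinOn (hw : ∀ e, 0 ≤ w e) {s : Set (Fin n → ℝ)}
    (hs : Convex ℝ s) (hmin : IsMinOn (weightedLoss w y) s x) (hx : x ∈ s) (hxz : x + z ∈ s) :
    0 ≤ ∑ e, pairScore w y x e * pairDiff z e := by
  have hsegment : ∀ t ∈ Set.Ioc (0 : ℝ) 1,
      0 ≤ ∑ e, pairScore w y (x + t • z) e * pairDiff z e := by
    intro t ht
    have hle : weightedLoss w y x ≤ weightedLoss w y (x + t • z) :=
      hmin (hs.add_smul_mem hx hxz ⟨ht.1.le, ht.2⟩)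
    have htangent := weightedLoss_tangent_le hw y (x + t • z) x
    have hslope : ∑ e, pairScore w y (x + t • z) e * (pairDiff x e - pairDiff (x + t • z) e) =
        -(t * ∑ e, pairScore w y (x + t • z) e * pairDiff z e) := by
      rw [Finset.mul_sum, ← Finset.sum_neg_distrib]
      refine Finset.sum_congr rfl fun e _ => ?_
      rw [← pairDiff_sub, sub_add_cancel_left, ← neg_smul, pairDiff_smul]
      ring
    exact nonneg_of_mul_nonneg_right (by linarith) ht.1
  have hcont : Continuous fun t : ℝ => ∑ e, pairScore w y (x + t • z) e * pairDiff z e :=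
    continuous_finsetSum _ fun e _ =>
      ((continuous_pairScore w y e).comp (by fun_prop : Continuous fun t : ℝ => x + t • z)).mul
        continuous_const
  have hlim : Filter.Tendsto (fun t : ℝ => ∑ e, pairScore w y (x + t • z) e * pairDiff z e)
      (nhdsWithin 0 (Set.Ioi 0)) (nhds (∑ e, pairScore w y x e * pairDiff z e)) := by
    simpa using (hcont.tendsto 0).mono_left (nhdsWithin_le_nhds (s := Set.Ioi 0))
  exact ge_of_tendsto hlim (Filter.eventually_of_mem (Ioc_mem_nhdsGT zero_lt_one) hsegment)

lemma isWeightedMLE_of_divergence_eq_zero (hw : ∀ e, 0 ≤ w e) (hx : ∑ i, x i = 0)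
    (hcrit : divergence (pairScore w y x) = 0) : IsWeightedMLE w y x := by
  refine ⟨hx, fun x' _ => ?_⟩
  have htangent := weightedLoss_tangent_le hw y x x'
  simpa only [← pairDiff_sub, ← sum_mul_divergence, hcrit, Pi.zero_apply, mul_zero,
    Finset.sum_const_zero, add_zero] using htangent

lemma eq_of_isWeightedMLE {x' : Fin n → ℝ} {Λ : ℝ} (hw : ∀ e, 0 ≤ w e) (hL : 0 < L) (hΛ : 0 < Λ)
    (hgap : HasSpectralGap (symWeight (curvature w θ)) Λ) (hx : ∑ i, x i = 0)
    (hcrit : divergence (pairScore w y x) = 0) (hx' : IsWeightedMLE w y x') : x' = x := by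
  have hflat : ∀ e, w e * pairDiff (x' - x) e = 0 := by
    intro e
    by_contra hne
    have hwe : 0 < w e := (hw e).lt_of_ne' (left_ne_zero_of_mul hne)
    have hdiff : pairDiff x e ≠ pairDiff x' e := fun h => hne (by
      rw [pairDiff_sub, h, sub_self, mul_zero])
    have hlt := weightedLoss_tangent_lt hw hL y hwe hdiff
    simp only [← pairDiff_sub, ← sum_mul_divergence, hcrit, Pi.zero_apply, mul_zero,
      Finset.sum_const_zero, add_zero] at hlt
    exact (hx'.2 x hx).not_gt hlt
  have henergy : energy (symWeight (curvature w θ)) (x' - x) = 0 := by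
    rw [energy_symWeight]
    refine Finset.sum_eq_zero fun e _ => ?_
    rw [curvature, sq, mul_mul_mul_comm, hflat, zero_mul]
  exact sub_eq_zero.mp (hgap.eq_zero_of_energy_nonpos hΛ
    (by simp [Finset.sum_sub_distrib, hx, hx'.1]) henergy.le)

end WeightedMLE

section NewtonStep

variable {n L : ℕ} {w : Pair n → ℝ} {θ x z : Fin n → ℝ} {y : Pair n → Fin L → Bool} {ε : ℝ}

lemma pairScore_sub_pairScore (hL : 0 < L) (w : Pair n → ℝ) (y : Pair n → Fin L → Bool)
    (x x' : Fin n → ℝ) (e : Pair n) :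
    pairScore w y x e - pairScore w y x' e =
      w e * (Real.sigmoid (pairDiff x e) - Real.sigmoid (pairDiff x' e)) := by
  have hL_ne : (L : ℝ) ≠ 0 := by positivity
  simp only [pairScore, Finset.sum_sub_distrib, Finset.sum_const, Finset.card_univ,
    Fintype.card_fin, nsmul_eq_mul]
  field

lemma abs_pairDiff_le (x : Fin n → ℝ) (e : Pair n) : |pairDiff x e| ≤ 2 * ‖x‖ :=
  calc |pairDiff x e| ≤ |x e.1.2| + |x e.1.1| := abs_sub _ _
    _ ≤ ‖x‖ + ‖x‖ := add_le_add (norm_le_pi_norm x _) (norm_le_pi_norm x _)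
    _ = 2 * ‖x‖ := (two_mul _).symm

lemma abs_pairScore_taylor_le (hw : ∀ e, 0 ≤ w e) (hL : 0 < L) (y : Pair n → Fin L → Bool)
    (hε : ε ≤ 1 / 2) (hx : ‖x - θ‖ ≤ ε) (e : Pair n) :
    |pairScore w y x e - pairScore w y θ e - curvature w θ e * pairDiff (x - θ) e| ≤
      36 * ε ^ 2 * curvature w θ e := by
  set h := pairDiff (x - θ) e with hh
  have hdiff : |h| ≤ 2 * ε := (abs_pairDiff_le _ _).trans (by linarith)
  have hx_eq : pairDiff x e = pairDiff θ e + h := by rw [hh, pairDiff_sub]; ring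
  have htaylor := abs_sigmoid_taylor_le (z := pairDiff θ e) (hdiff.trans (by linarith))
  have hsq : h ^ 2 ≤ (2 * ε) ^ 2 := sq_le_sq' (abs_le.mp hdiff).1 (abs_le.mp hdiff).2
  have hderiv := (sigmoidDeriv_pos (pairDiff θ e)).le
  rw [pairScore_sub_pairScore hL, hx_eq, curvature, mul_assoc, ← mul_sub, abs_mul,
    abs_of_nonneg (hw e)]
  calc w e * |Real.sigmoid (pairDiff θ e + h) - Real.sigmoid (pairDiff θ e) -
        sigmoidDeriv (pairDiff θ e) * h|
      ≤ w e * (9 * sigmoidDeriv (pairDiff θ e) * (2 * ε) ^ 2) :=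
        mul_le_mul_of_nonneg_left (htaylor.trans (by gcongr)) (hw e)
    _ = 36 * ε ^ 2 * (w e * sigmoidDeriv (pairDiff θ e)) := by ring

lemma sum_newton_mul_laplacian
    (hz : laplacian (symWeight (curvature w θ)) z = -divergence (pairScore w y x))
    (u : Fin n → ℝ) :
    ∑ j, (x + z - θ) j * laplacian (symWeight (curvature w θ)) u j =
      -(∑ e, (pairScore w y x e - pairScore w y θ e - curvature w θ e * pairDiff (x - θ) e) *
          pairDiff u e) - ∑ e, pairScore w y θ e * pairDiff u e := by
  have hstep : ∑ j, z j * laplacian (symWeight (curvature w θ)) u j =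
      -∑ e, pairScore w y x e * pairDiff u e := by
    rw [sum_mul_laplacian_comm (symWeight_comm _), hz, ← sum_mul_divergence,
      ← Finset.sum_neg_distrib]
    exact Finset.sum_congr rfl fun j _ => mul_neg _ _
  rw [add_sub_right_comm]
  simp only [Pi.add_apply, add_mul, Finset.sum_add_distrib]
  rw [hstep, sum_mul_laplacian_symWeight]
  simp only [sub_mul, Finset.sum_sub_distrib, mul_assoc]
  ring

lemma norm_newton_sub_le {u : Fin n → Fin n → ℝ} {E B : ℝ} (hw : ∀ e, 0 ≤ w e) (hL : 0 < L)
    (hε : ε ≤ 1 / 2) (hB : 144 * ε * B ≤ 1)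
    (hu : ∀ i, IsApproxGreen (symWeight (curvature w θ)) i E B (u i))
    (hnoise : ∀ i, |∑ e, pairScore w y θ e * pairDiff (u i) e| ≤ ε / 8)
    (hx : ‖x - θ‖ ≤ ε) (hsum : ∑ i, (x + z - θ) i = 0)
    (hz : laplacian (symWeight (curvature w θ)) z = -divergence (pairScore w y x)) :
    ‖x + z - θ‖ ≤ ε / 2 := by
  have hε_nonneg : 0 ≤ ε := (norm_nonneg _).trans hx
  refine (pi_norm_le_iff_of_nonneg (by linarith)).mpr fun i => ?_
  have : Nonempty (Fin n) := ⟨i⟩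
  obtain ⟨k, hk⟩ := Finite.exists_max fun i => |(x + z - θ) i|
  have hremainder : |∑ e, (pairScore w y x e - pairScore w y θ e -
      curvature w θ e * pairDiff (x - θ) e) * pairDiff (u k) e| ≤ ε / 8 := by
    calc |∑ e, (pairScore w y x e - pairScore w y θ e -
          curvature w θ e * pairDiff (x - θ) e) * pairDiff (u k) e|
        ≤ ∑ e, 36 * ε ^ 2 * curvature w θ e * |pairDiff (u k) e| := by
          refine (Finset.abs_sum_le_sum_abs _ _).trans (Finset.sum_le_sum fun e _ => ?_)
          rw [abs_mul]
          gcongr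
          exact abs_pairScore_taylor_le hw hL y hε hx e
      _ = 18 * ε ^ 2 * totalVariation (symWeight (curvature w θ)) (u k) := by
          simp only [totalVariation_symWeight, Finset.mul_sum]
          exact Finset.sum_congr rfl fun e _ => by ring
      _ ≤ 18 * ε ^ 2 * B := by gcongr; exact (hu k).totalVariation_le
      _ = ε / 8 * (144 * ε * B) := by ring
      _ ≤ ε / 8 := mul_le_of_le_one_right (by linarith) hB
  calc |(x + z - θ) i| ≤ |(x + z - θ) k| := hk i
    _ ≤ 2 * |∑ j, (x + z - θ) j * laplacian (symWeight (curvature w θ)) (u k) j| :=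
        (hu k).abs_apply_le hsum hk
    _ ≤ 2 * (ε / 8 + ε / 8) := by
        rw [sum_newton_mul_laplacian hz]
        gcongr
        refine (abs_sub _ _).trans (add_le_add ?_ (hnoise k))
        rwa [abs_neg]
    _ = ε / 2 := by ring

/- The Newton step from a minimizer over the box of radius `ε` stays in the box, so the loss has
nonnegative slope along it; its slope is also minus the energy of the step. -/
lemma exists_divergence_pairScore_eq_zero {u : Fin n → Fin n → ℝ} {E B Λ : ℝ} (hw : ∀ e, 0 ≤ w e)
    (hL : 0 < L) (hθ : ∑ i, θ i = 0) (hε_nonneg : 0 ≤ ε) (hε : ε ≤ 1 / 2)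
    (hB : 144 * ε * B ≤ 1) (hΛ : 0 < Λ) (hgap : HasSpectralGap (symWeight (curvature w θ)) Λ)
    (hu : ∀ i, IsApproxGreen (symWeight (curvature w θ)) i E B (u i))
    (hnoise : ∀ i, |∑ e, pairScore w y θ e * pairDiff (u i) e| ≤ ε / 8) :
    ∃ x, ∑ i, x i = 0 ∧ ‖x - θ‖ ≤ ε ∧ divergence (pairScore w y x) = 0 := by
  set s : Set (Fin n → ℝ) := Metric.closedBall θ ε ∩ {x | ∑ i, x i = 0}
  have hconvex : Convex ℝ s := (convex_closedBall θ ε).inter fun x hx x' hx' a b _ _ _ => by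
    simp_all [Finset.sum_add_distrib, ← Finset.mul_sum]
  have hcompact : IsCompact s := (isCompact_closedBall θ ε).inter_right
    (isClosed_eq (by fun_prop) continuous_const)
  obtain ⟨x, hxs, hmin⟩ := hcompact.exists_isMinOn ⟨θ, Metric.mem_closedBall_self hε_nonneg, hθ⟩
    (continuous_weightedLoss w y).continuousOn
  have hx : ‖x - θ‖ ≤ ε := mem_closedBall_iff_norm.mp hxs.1
  have hx_sum : ∑ i, x i = 0 := hxs.2
  obtain ⟨z, hz_sum, hz⟩ := hgap.exists_laplacian_eq (symWeight_comm _) hΛ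
    (b := -divergence (pairScore w y x)) (by simp [sum_divergence])
  have hxz : x + z ∈ s := by
    refine ⟨mem_closedBall_iff_norm.mpr ?_, by simp [Finset.sum_add_distrib, hx_sum, hz_sum]⟩
    exact (norm_newton_sub_le hw hL hε hB hu hnoise hx
      (by simp [Finset.sum_add_distrib, hx_sum, hz_sum, hθ]) hz).trans (by linarith)
  have hslope := sum_pairScore_mul_nonneg_of_isMinOn hw hconvex hmin hxs hxz
  have henergy : energy (symWeight (curvature w θ)) z ≤ 0 := by
    rw [← sum_mul_laplacian_self (symWeight_comm _), hz]
    simpa [sum_mul_divergence] using hslope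
  have hz_zero : z = 0 := hgap.eq_zero_of_energy_nonpos hΛ hz_sum henergy
  exact ⟨x, hx_sum, hx, by rw [← neg_eq_zero, ← hz, hz_zero, map_zero]⟩

theorem exists_isWeightedMLE_near {u : Fin n → Fin n → ℝ} {E B Λ : ℝ} (hw : ∀ e, 0 ≤ w e)
    (hL : 0 < L) (hθ : ∑ i, θ i = 0) (hε_nonneg : 0 ≤ ε) (hε : ε ≤ 1 / 2)
    (hB : 144 * ε * B ≤ 1) (hΛ : 0 < Λ) (hgap : HasSpectralGap (symWeight (curvature w θ)) Λ)
    (hu : ∀ i, IsApproxGreen (symWeight (curvature w θ)) i E B (u i))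
    (hnoise : ∀ i, |∑ e, pairScore w y θ e * pairDiff (u i) e| ≤ ε / 8) :
    ∃ x, IsWeightedMLE w y x ∧ ‖x - θ‖ ≤ ε ∧ ∀ x', IsWeightedMLE w y x' → x' = x := by
  obtain ⟨x, hx_sum, hx, hcrit⟩ :=
    exists_divergence_pairScore_eq_zero hw hL hθ hε_nonneg hε hB hΛ hgap hu hnoise
  exact ⟨x, isWeightedMLE_of_divergence_eq_zero hw hx_sum hcrit, hx, fun x' hx' =>
    eq_of_isWeightedMLE hw hL hΛ hgap hx_sum hcrit hx'⟩

end NewtonStep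

section TopK

variable {n K : ℕ} {x : Fin n → ℝ}

lemma recoversTopK_of_lt (hK : K ≤ n)
    (h : ∀ i j : Fin n, (i : ℕ) < K → K ≤ (j : ℕ) → x j < x i) : RecoversTopK x K := by
  intro S
  have hcard : #{i : Fin n | (i : ℕ) < K} = K := by
    rw [Fin.card_filter_val_lt, min_eq_right hK]
  constructor
  · rintro ⟨hS, htop⟩
    have hsub : ({i : Fin n | (i : ℕ) < K} : Finset (Fin n)) ⊆ S := by
      by_contra hnot
      obtain ⟨j, hjK, hjS⟩ := Finset.not_subset.mp hnot
      obtain ⟨i, hiS, hiK⟩ : ∃ i ∈ S, i ∉ ({i : Fin n | (i : ℕ) < K} : Finset (Fin n)) := by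
        by_contra! hall
        exact hnot (Finset.eq_of_subset_of_card_le hall (by rw [hcard, hS])).ge
      simp only [Finset.mem_filter_univ, not_lt] at hjK hiK
      exact (h j i hjK hiK).not_ge (htop i hiS j hjS)
    exact (Finset.eq_of_subset_of_card_le hsub (by rw [hcard, hS])).symm
  · rintro rfl
    refine ⟨hcard, fun i hi j hj => ?_⟩
    simp only [Finset.mem_filter_univ, not_lt] at hi hj
    exact (h i j hi hj).le

lemma recoversTopK_of_norm_sub_le {θ : Fin n → ℝ} {ε : ℝ} (hKn : K < n) (hθ : Antitone θ)
    (hx : ‖x - θ‖ ≤ ε) (hgap : 2 * ε < scoreGap θ K hKn) : RecoversTopK x K := by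
  refine recoversTopK_of_lt hKn.le fun i j hi hj => ?_
  have happrox : ∀ i, |x i - θ i| ≤ ε := fun i => (norm_le_pi_norm (x - θ) i).trans hx
  have hi_top : θ ⟨K - 1, lt_of_le_of_lt (Nat.sub_le K 1) hKn⟩ ≤ θ i :=
    hθ (Fin.le_def.mpr (by dsimp only; omega) : i ≤ ⟨K - 1, _⟩)
  have hj_bottom : θ j ≤ θ ⟨K, hKn⟩ := hθ (Fin.mk_le_mk.mpr hj : (⟨K, hKn⟩ : Fin n) ≤ j)
  have hi_ge := (abs_le.mp (happrox i)).1
  have hj_le := (abs_le.mp (happrox j)).2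
  unfold scoreGap at hgap
  linarith

end TopK

section Concentration

variable {Ω : Type*} [MeasurableSpace Ω] {μ : Measure Ω} [IsProbabilityMeasure μ]

lemma mgf_le_of_mem_Icc_zero_one {X : Ω → ℝ} (hX : Measurable X)
    (hX01 : ∀ ω, X ω ∈ Set.Icc 0 1) (t : ℝ) :
    mgf X μ t ≤ Real.exp (μ[X] * (Real.exp t - 1)) := by
  have hX_int : Integrable X μ := Integrable.of_mem_Icc 0 1 hX.aemeasurable (ae_of_all _ hX01)
  have hchord : ∀ ω, Real.exp (t * X ω) ≤ 1 + X ω * (Real.exp t - 1) := by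
    intro ω
    have := convexOn_exp.2 (Set.mem_univ 0) (Set.mem_univ t) (sub_nonneg.mpr (hX01 ω).2)
      (hX01 ω).1 (sub_add_cancel _ _)
    simp only [smul_eq_mul, mul_zero, zero_add, Real.exp_zero, mul_one] at this
    rw [mul_comm t]
    linarith
  calc mgf X μ t ≤ ∫ ω, 1 + X ω * (Real.exp t - 1) ∂μ :=
        integral_mono (integrable_exp_mul_of_mem_Icc hX.aemeasurable (ae_of_all _ hX01))
          ((integrable_const 1).add (hX_int.mul_const _)) hchord
    _ = μ[X] * (Real.exp t - 1) + 1 := by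
        rw [integral_add (integrable_const 1) (hX_int.mul_const _), integral_mul_const,
          integral_const, probReal_univ, one_smul, add_comm]
    _ ≤ Real.exp (μ[X] * (Real.exp t - 1)) := Real.add_one_le_exp _

variable {ι : Type*} {X : ι → Ω → ℝ}

lemma mgf_sum_le_of_mem_Icc_zero_one (hX : ∀ i, Measurable (X i))
    (hX01 : ∀ i ω, X i ω ∈ Set.Icc 0 1) (hindep : iIndepFun X μ) (S : Finset ι) (t : ℝ) :
    mgf (∑ i ∈ S, X i) μ t ≤ Real.exp ((∑ i ∈ S, μ[X i]) * (Real.exp t - 1)) := by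
  rw [hindep.mgf_sum hX, Finset.sum_mul, Real.exp_sum]
  exact Finset.prod_le_prod (fun i _ => mgf_nonneg) fun i _ =>
    mgf_le_of_mem_Icc_zero_one (hX i) (hX01 i) t

lemma integrable_exp_mul_sum_of_mem_Icc_zero_one (hX : ∀ i, Measurable (X i))
    (hX01 : ∀ i ω, X i ω ∈ Set.Icc 0 1) (hindep : iIndepFun X μ) (S : Finset ι) (t : ℝ) :
    Integrable (fun ω => Real.exp (t * (∑ i ∈ S, X i) ω)) μ :=
  hindep.integrable_exp_mul_sum hX fun i _ =>
    integrable_exp_mul_of_mem_Icc (hX i).aemeasurable (ae_of_all _ (hX01 i))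

/- Chernoff's method with parameter `-1`. -/
lemma measureReal_sum_le_half_le (hX : ∀ i, Measurable (X i))
    (hX01 : ∀ i ω, X i ω ∈ Set.Icc 0 1) (hindep : iIndepFun X μ) (S : Finset ι) {m : ℝ}
    (hm : m ≤ ∑ i ∈ S, μ[X i]) :
    μ.real {ω | ∑ i ∈ S, X i ω ≤ m / 2} ≤ Real.exp (-(m / 8)) := by
  have htail := measure_le_le_exp_mul_mgf (m / 2) (by norm_num : (-1 : ℝ) ≤ 0)
    (integrable_exp_mul_sum_of_mem_Icc_zero_one hX hX01 hindep S (-1))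
  simp only [Finset.sum_apply] at htail
  have hmean_nonneg : 0 ≤ ∑ i ∈ S, μ[X i] :=
    Finset.sum_nonneg fun i _ => integral_nonneg fun ω => (hX01 i ω).1
  have hexp : Real.exp (-1) - 1 ≤ -(5 / 8) := by
    have : Real.exp (-1) < 3 / 8 := Real.exp_neg_one_lt_d9.trans (by norm_num)
    linarith
  calc μ.real {ω | ∑ i ∈ S, X i ω ≤ m / 2}
      ≤ Real.exp (- -1 * (m / 2)) *
          Real.exp ((∑ i ∈ S, μ[X i]) * (Real.exp (-1) - 1)) := by
        refine htail.trans ?_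
        gcongr
        exact mgf_sum_le_of_mem_Icc_zero_one hX hX01 hindep S (-1)
    _ ≤ Real.exp (-(m / 8)) := by
        rw [← Real.exp_add]
        refine Real.exp_le_exp.mpr ?_
        have := mul_le_mul_of_nonneg_left hexp hmean_nonneg
        linarith

/- Chernoff's method with parameter `1`. -/
lemma measureReal_four_mul_le_sum_le (hX : ∀ i, Measurable (X i))
    (hX01 : ∀ i ω, X i ω ∈ Set.Icc 0 1) (hindep : iIndepFun X μ) (S : Finset ι) {m : ℝ}
    (hm : ∑ i ∈ S, μ[X i] ≤ m) :
    μ.real {ω | 4 * m ≤ ∑ i ∈ S, X i ω} ≤ Real.exp (-(2 * m)) := by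
  have htail := measure_ge_le_exp_mul_mgf (4 * m) (zero_le_one (α := ℝ))
    (integrable_exp_mul_sum_of_mem_Icc_zero_one hX hX01 hindep S 1)
  simp only [Finset.sum_apply] at htail
  have hmean_nonneg : 0 ≤ ∑ i ∈ S, μ[X i] :=
    Finset.sum_nonneg fun i _ => integral_nonneg fun ω => (hX01 i ω).1
  have hexp : Real.exp 1 - 1 ≤ 2 := by linarith [Real.exp_one_lt_d9]
  calc μ.real {ω | 4 * m ≤ ∑ i ∈ S, X i ω}
      ≤ Real.exp (-1 * (4 * m)) * Real.exp ((∑ i ∈ S, μ[X i]) * (Real.exp 1 - 1)) := by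
        refine htail.trans ?_
        gcongr
        exact mgf_sum_le_of_mem_Icc_zero_one hX hX01 hindep S 1
    _ ≤ Real.exp (-(2 * m)) := by
        rw [← Real.exp_add]
        refine Real.exp_le_exp.mpr ?_
        have := mul_le_mul_of_nonneg_left hexp hmean_nonneg
        linarith

lemma hasSubgaussianMGF_sum_mul_sub_integral [Fintype ι] (hX : ∀ i, Measurable (X i))
    (hX01 : ∀ i ω, X i ω ∈ Set.Icc 0 1) (hindep : iIndepFun X μ) (c : ι → ℝ) :
    HasSubgaussianMGF (fun ω => ∑ i, c i * (X i ω - μ[X i]))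
      (Real.toNNReal ((∑ i, c i ^ 2) / 4)) μ := by
  have hterm : ∀ i, HasSubgaussianMGF (fun ω => c i * (X i ω - μ[X i]))
      (Real.toNNReal (c i ^ 2 / 4)) μ := fun i => by
    convert (hasSubgaussianMGF_of_mem_Icc (μ := μ) (hX i).aemeasurable
      (ae_of_all _ (hX01 i))).const_mul (c i) using 1
    ext
    rw [Real.coe_toNNReal _ (by positivity)]
    change c i ^ 2 / 4 = c i ^ 2 * (‖(1 : ℝ) - 0‖ / 2) ^ 2
    rw [sub_zero, norm_one]
    ring
  have hindep_terms : iIndepFun (fun i ω => c i * (X i ω - μ[X i])) μ :=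
    hindep.comp (fun i x => c i * (x - ∫ ω, X i ω ∂μ)) fun i => by fun_prop
  convert HasSubgaussianMGF.sum_of_iIndepFun hindep_terms (s := Finset.univ)
    fun i _ => hterm i using 1
  rw [Finset.sum_div, Real.toNNReal_sum_of_nonneg fun i _ => by positivity]

lemma measureReal_le_sum_mul_sub_integral_le [Fintype ι] (hX : ∀ i, Measurable (X i))
    (hX01 : ∀ i ω, X i ω ∈ Set.Icc 0 1) (hindep : iIndepFun X μ) (c : ι → ℝ) {v s : ℝ}
    (hv : ∑ i, c i ^ 2 ≤ v) (hs : 0 ≤ s) :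
    μ.real {ω | s ≤ ∑ i, c i * (X i ω - μ[X i])} ≤ Real.exp (-(2 * s ^ 2 / v)) := by
  have hv_nonneg : 0 ≤ v := (Finset.sum_nonneg fun i _ => sq_nonneg (c i)).trans hv
  have hsub := hasSubgaussianMGF_sum_mul_sub_integral hX hX01 hindep c
  have hsub_v : HasSubgaussianMGF (fun ω => ∑ i, c i * (X i ω - μ[X i]))
      (Real.toNNReal (v / 4)) μ :=
    ⟨hsub.integrable_exp_mul, fun t => (hsub.mgf_le t).trans (by gcongr)⟩
  refine (hsub_v.measure_ge_le hs).trans_eq ?_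
  rw [Real.coe_toNNReal _ (by positivity), neg_div,
    show 2 * (v / 4) = v / 2 by ring, div_div_eq_mul_div, mul_comm]

lemma measureReal_le_abs_sum_mul_sub_integral_le [Fintype ι] (hX : ∀ i, Measurable (X i))
    (hX01 : ∀ i ω, X i ω ∈ Set.Icc 0 1) (hindep : iIndepFun X μ) (c : ι → ℝ) {v s : ℝ}
    (hv : ∑ i, c i ^ 2 ≤ v) (hs : 0 ≤ s) :
    μ.real {ω | s ≤ |∑ i, c i * (X i ω - μ[X i])|} ≤ 2 * Real.exp (-(2 * s ^ 2 / v)) := by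
  have hpos := measureReal_le_sum_mul_sub_integral_le hX hX01 hindep c hv hs
  have hneg := measureReal_le_sum_mul_sub_integral_le hX hX01 hindep (fun i => -c i)
    (by simpa using hv) hs
  have hsplit : {ω | s ≤ |∑ i, c i * (X i ω - μ[X i])|} =
      {ω | s ≤ ∑ i, c i * (X i ω - μ[X i])} ∪ {ω | s ≤ ∑ i, -c i * (X i ω - μ[X i])} := by
    ext ω
    simp only [Set.mem_ofPred_eq, Set.mem_union, neg_mul, Finset.sum_neg_distrib, le_abs]
  rw [hsplit]
  exact (measureReal_union_le _ _).trans (by linarith)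

lemma measureReal_prodMk_mem_le_of_indepFun {α β : Type*} [MeasurableSpace α]
    [MeasurableSpace β] {Y : Ω → α} {Z : Ω → β} (hY : Measurable Y) (hZ : Measurable Z)
    (hYZ : IndepFun Y Z μ) {S : Set (α × β)} (hS : MeasurableSet S) {η : ℝ}
    (h : ∀ a, μ.real {ω | (a, Z ω) ∈ S} ≤ η) : μ.real {ω | (Y ω, Z ω) ∈ S} ≤ η := by
  obtain ⟨ω₀⟩ := μ.nonempty_of_neZero
  refine ENNReal.toReal_le_of_le_ofReal (measureReal_nonneg.trans (h (Y ω₀))) ?_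
  have hfiber : ∀ a, μ.map Z (Prod.mk a ⁻¹' S) ≤ ENNReal.ofReal η := fun a => by
    rw [Measure.map_apply hZ (measurable_prodMk_left hS)]
    exact (ENNReal.le_ofReal_iff_toReal_le (measure_ne_top _ _)
      (measureReal_nonneg.trans (h a))).mpr (h a)
  have := Measure.isProbabilityMeasure_map (μ := μ) hY.aemeasurable
  calc μ {ω | (Y ω, Z ω) ∈ S} = (μ.map Y).prod (μ.map Z) S := by
        rw [← (indepFun_iff_map_prod_eq_prod_map_map hY.aemeasurable hZ.aemeasurable).mp hYZ,
          Measure.map_apply (hY.prodMk hZ) hS]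
        rfl
    _ = ∫⁻ a, μ.map Z (Prod.mk a ⁻¹' S) ∂μ.map Y := Measure.prod_apply hS
    _ ≤ ∫⁻ _, ENNReal.ofReal η ∂μ.map Y := lintegral_mono hfiber
    _ = ENNReal.ofReal η := by rw [lintegral_const, measure_univ, mul_one]

end Concentration

section Cuts

variable {n : ℕ}

/-- The pairs with one end in `A` and the other outside `D`: for `A ⊆ D`, the cut between `A` and
the complement of `D`. -/
def cutPairs (A D : Finset (Fin n)) : Finset (Pair n) :=
  {e | e.1.1 ∈ A ∧ e.1.2 ∉ D ∨ e.1.2 ∈ A ∧ e.1.1 ∉ D}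

lemma sum_symWeight_cut {A D : Finset (Fin n)} (hAD : A ⊆ D) (f : Pair n → ℝ) :
    ∑ a ∈ A, ∑ b ∈ Dᶜ, symWeight f a b = ∑ e ∈ cutPairs A D, f e := by
  calc ∑ a ∈ A, ∑ b ∈ Dᶜ, symWeight f a b
      = ∑ a, ∑ b, symWeight f a b * if a ∈ A ∧ b ∉ D then 1 else 0 := by
        simp only [ite_and, mul_ite, mul_one, mul_zero, ← Finset.mem_compl,
          Finset.sum_ite_irrel, Finset.sum_const_zero, Finset.sum_ite_mem, Finset.univ_inter]
    _ = ∑ e ∈ cutPairs A D, f e := by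
        rw [sum_symWeight_mul f fun a b => if a ∈ A ∧ b ∉ D then 1 else 0, cutPairs,
          Finset.sum_filter]
        refine Finset.sum_congr rfl fun e _ => ?_
        by_cases hfst : e.1.1 ∈ A ∧ e.1.2 ∉ D
        · have hsnd : ¬(e.1.2 ∈ A ∧ e.1.1 ∉ D) := fun h => h.2 (hAD hfst.1)
          simp only [hfst, hsnd, true_or, and_self, not_false_eq_true, if_true, if_false,
            add_zero, mul_one]
        · simp only [hfst, false_or, if_false, zero_add, mul_ite, mul_one, mul_zero]

lemma symWeight_one {i j : Fin n} (h : i ≠ j) : symWeight (fun _ => 1) i j = 1 := by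
  rcases h.lt_or_gt with h | h <;> simp [symWeight, lowerWeight, h, h.le]

lemma card_cutPairs {A D : Finset (Fin n)} (hAD : A ⊆ D) : #(cutPairs A D) = #A * #Dᶜ := by
  have hcut := sum_symWeight_cut hAD fun _ => 1
  have hone : ∀ a ∈ A, ∀ b ∈ Dᶜ, symWeight (fun _ => 1) a b = 1 := fun a ha b hb =>
    symWeight_one fun hab => Finset.mem_compl.mp hb (hab ▸ hAD ha)
  rw [Finset.sum_congr rfl fun a ha => Finset.sum_congr rfl (hone a ha)] at hcut
  simp only [Finset.sum_const, nsmul_eq_mul, mul_one] at hcut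
  exact_mod_cast hcut.symm

lemma sum_symWeight_row (f : Pair n → ℝ) (i : Fin n) :
    ∑ j, symWeight f i j = ∑ e ∈ cutPairs {i} {i}, f e := by
  have hdiag : symWeight f i i = 0 := by simp [symWeight, lowerWeight]
  rw [← sum_symWeight_cut subset_rfl, Finset.sum_singleton,
    ← Finset.sum_add_sum_compl {i} fun j => symWeight f i j, Finset.sum_singleton, hdiag, zero_add]

end Cuts

lemma exp_neg_nat_mul_log {n : ℕ} (hn : 0 < n) (m : ℕ) :
    Real.exp (-(m * Real.log n)) = ((n : ℝ) ^ m)⁻¹ := by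
  rw [Real.exp_neg, Real.exp_nat_mul, Real.exp_log (by positivity)]

lemma sum_inv_sq_pow_card_le {n : ℕ} (hn : 0 < n) :
    ∑ A : Finset (Fin n), ((n : ℝ) ^ 2)⁻¹ ^ #A ≤ 3 := by
  have hbinom := Fintype.sum_pow_mul_eq_add_pow (Fin n) ((n : ℝ) ^ 2)⁻¹ 1
  simp only [one_pow, mul_one, Fintype.card_fin] at hbinom
  have hn_one : (1 : ℝ) ≤ n := by exact_mod_cast hn
  calc ∑ A : Finset (Fin n), ((n : ℝ) ^ 2)⁻¹ ^ #A = (((n : ℝ) ^ 2)⁻¹ + 1) ^ n := hbinom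
    _ ≤ Real.exp ((n : ℝ) ^ 2)⁻¹ ^ n := by
        gcongr
        exact Real.add_one_le_exp _
    _ = Real.exp (n : ℝ)⁻¹ := by
        rw [← Real.exp_nat_mul]
        congr 1
        field
    _ ≤ Real.exp 1 := Real.exp_le_exp.mpr (inv_le_one_of_one_le₀ hn_one)
    _ ≤ 3 := by linarith [Real.exp_one_lt_d9]

section RandomWeights

variable {Ω : Type*} [MeasurableSpace Ω] {μ : Measure Ω} [IsProbabilityMeasure μ] {n : ℕ}
  {X : Pair n → Ω → ℝ}

lemma measureReal_cut_lt_le (hn : 0 < n) (hX : ∀ e, Measurable (X e))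
    (hX01 : ∀ e ω, X e ω ∈ Set.Icc 0 1) (hindep : iIndepFun X μ) {q : ℝ}
    (hq : ∀ e, q ≤ μ[X e]) (hnq : 480 * Real.log n ≤ n * q) {A D : Finset (Fin n)} (hAD : A ⊆ D)
    (hD : 2 * #D ≤ n) (hDA : #D ≤ 8 * #A) :
    μ.real {ω | ∑ a ∈ A, ∑ b ∈ Dᶜ, symWeight (X · ω) a b < n * q / 4 * #A} ≤
      ((n : ℝ) ^ 12)⁻¹ * (((n : ℝ) ^ 2)⁻¹ ^ #A * ((n : ℝ) ^ 2)⁻¹ ^ #D) := by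
  rcases A.eq_empty_or_nonempty with rfl | hA
  · simp only [Finset.sum_empty, Finset.card_empty, Nat.cast_zero, mul_zero, lt_self_iff_false,
      Set.ofPred_false, measureReal_empty]
    positivity
  have hA_card : 1 ≤ #A := hA.card_pos
  have hn_one : (1 : ℝ) ≤ n := by exact_mod_cast hn
  have hq_nonneg : 0 ≤ q := by
    have := Real.log_nonneg hn_one
    exact nonneg_of_mul_nonneg_right ((by positivity : 0 ≤ 480 * Real.log n).trans hnq)
      (by positivity)
  have hcut_card : (n : ℝ) / 2 * #A ≤ #(cutPairs A D) := by
    rw [card_cutPairs hAD, Finset.card_compl, Fintype.card_fin, Nat.cast_mul,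
      Nat.cast_sub (by omega), mul_comm]
    have : 2 * (#D : ℝ) ≤ n := by exact_mod_cast hD
    gcongr
    linarith
  have hmean : n * q / 2 * #A ≤ ∑ e ∈ cutPairs A D, μ[X e] :=
    calc n * q / 2 * #A = n / 2 * #A * q := by ring
      _ ≤ #(cutPairs A D) * q := by gcongr
      _ ≤ ∑ e ∈ cutPairs A D, μ[X e] := by
          rw [← nsmul_eq_mul]
          exact Finset.card_nsmul_le_sum _ _ _ fun e _ => hq e
  calc μ.real {ω | ∑ a ∈ A, ∑ b ∈ Dᶜ, symWeight (X · ω) a b < n * q / 4 * #A}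
      ≤ μ.real {ω | ∑ e ∈ cutPairs A D, X e ω ≤ n * q / 2 * #A / 2} := by
        refine measureReal_mono fun ω hω => ?_
        simp only [Set.mem_ofPred_eq, sum_symWeight_cut hAD] at hω ⊢
        linarith
    _ ≤ Real.exp (-(n * q / 2 * #A / 8)) :=
        measureReal_sum_le_half_le hX hX01 hindep _ hmean
    _ ≤ Real.exp (-((30 * #A : ℕ) * Real.log n)) := by
        have := mul_le_mul_of_nonneg_left hnq (Nat.cast_nonneg (α := ℝ) #A)
        gcongr
        push_cast
        linarith
    _ ≤ ((n : ℝ) ^ (12 + (2 * #A + 2 * #D)))⁻¹ := by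
        rw [exp_neg_nat_mul_log hn]
        gcongr
        omega
    _ = ((n : ℝ) ^ 12)⁻¹ * (((n : ℝ) ^ 2)⁻¹ ^ #A * ((n : ℝ) ^ 2)⁻¹ ^ #D) := by
        rw [pow_add, pow_add, pow_mul, pow_mul, mul_inv, mul_inv, inv_pow, inv_pow]

/- Union bound over all cuts; the bound on a single cut decays fast enough in `#A` and `#D` to be
summed over all subsets. -/
lemma measureReal_not_hasSmallSetExpansion_le (hn : 0 < n) (hX : ∀ e, Measurable (X e))
    (hX01 : ∀ e ω, X e ω ∈ Set.Icc 0 1) (hindep : iIndepFun X μ) {q : ℝ}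
    (hq : ∀ e, q ≤ μ[X e]) (hnq : 480 * Real.log n ≤ n * q) :
    μ.real {ω | ¬HasSmallSetExpansion (symWeight (X · ω)) (n * q / 4)} ≤
      9 * ((n : ℝ) ^ 10)⁻¹ := by
  set cutBound : Finset (Fin n) → Finset (Fin n) → ℝ := fun A D =>
    ((n : ℝ) ^ 12)⁻¹ * (((n : ℝ) ^ 2)⁻¹ ^ #A * ((n : ℝ) ^ 2)⁻¹ ^ #D)
  set sparse : Finset (Fin n) × Finset (Fin n) → Set Ω := fun (A, D) =>
    {ω | (A ⊆ D ∧ 2 * #D ≤ n ∧ #D ≤ 8 * #A) ∧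
      ∑ a ∈ A, ∑ b ∈ Dᶜ, symWeight (X · ω) a b < n * q / 4 * #A}
  have hsparse : ∀ A D, μ.real (sparse (A, D)) ≤ cutBound A D := fun A D => by
    by_cases h : A ⊆ D ∧ 2 * #D ≤ n ∧ #D ≤ 8 * #A
    · simp only [sparse, h, and_self, true_and]
      exact measureReal_cut_lt_le hn hX hX01 hindep hq hnq h.1 h.2.1 h.2.2
    · simp only [sparse, h, false_and, Set.ofPred_false, measureReal_empty, cutBound]
      positivity
  have hcover : {ω | ¬HasSmallSetExpansion (symWeight (X · ω)) (n * q / 4)} ⊆ ⋃ s, sparse s := by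
    intro ω hω
    simp only [HasSmallSetExpansion, Set.mem_ofPred_eq, Fintype.card_fin] at hω
    push Not at hω
    obtain ⟨A, D, hAD, hD, hDA, hlt⟩ := hω
    exact Set.mem_iUnion.mpr ⟨(A, D), ⟨hAD, hD, hDA⟩, hlt⟩
  have hn_one : (1 : ℝ) ≤ n := by exact_mod_cast hn
  have hsum := sum_inv_sq_pow_card_le hn
  calc μ.real {ω | ¬HasSmallSetExpansion (symWeight (X · ω)) (n * q / 4)}
      ≤ ∑ s, μ.real (sparse s) :=
        (measureReal_mono hcover).trans (measureReal_iUnion_fintype_le _)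
    _ ≤ ∑ A, ∑ D, cutBound A D := by
        rw [Fintype.sum_prod_type]
        exact Finset.sum_le_sum fun A _ => Finset.sum_le_sum fun D _ => hsparse A D
    _ = ((n : ℝ) ^ 12)⁻¹ * ((∑ A : Finset (Fin n), ((n : ℝ) ^ 2)⁻¹ ^ #A) *
          ∑ D : Finset (Fin n), ((n : ℝ) ^ 2)⁻¹ ^ #D) := by
        rw [Finset.sum_mul_sum]
        simp only [cutBound, Finset.mul_sum]
    _ ≤ ((n : ℝ) ^ 10)⁻¹ * (3 * 3) := by
        gcongr
        norm_num
    _ = 9 * ((n : ℝ) ^ 10)⁻¹ := by ring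

lemma measureReal_exists_lt_sum_symWeight_le (hn : 0 < n) (hX : ∀ e, Measurable (X e))
    (hX01 : ∀ e ω, X e ω ∈ Set.Icc 0 1) (hindep : iIndepFun X μ) {m : Fin n → ℝ}
    (hm : ∀ i, ∑ j, symWeight (fun e => μ[X e]) i j ≤ m i)
    (hlog : ∀ i, 11 * Real.log n ≤ 2 * m i) :
    μ.real {ω | ∃ i, 4 * m i < ∑ j, symWeight (X · ω) i j} ≤ ((n : ℝ) ^ 10)⁻¹ := by
  have hrow : ∀ i, μ.real {ω | 4 * m i < ∑ j, symWeight (X · ω) i j} ≤ ((n : ℝ) ^ 11)⁻¹ :=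
    fun i => by
      simp only [sum_symWeight_row] at hm ⊢
      calc μ.real {ω | 4 * m i < ∑ e ∈ cutPairs {i} {i}, X e ω}
          ≤ μ.real {ω | 4 * m i ≤ ∑ e ∈ cutPairs {i} {i}, X e ω} :=
            measureReal_mono (Set.ofPred_subset_ofPred.mpr fun ω => le_of_lt)
        _ ≤ Real.exp (-(2 * m i)) := measureReal_four_mul_le_sum_le hX hX01 hindep _ (hm i)
        _ ≤ Real.exp (-((11 : ℕ) * Real.log n)) := by
            push_cast
            exact Real.exp_le_exp.mpr (neg_le_neg (hlog i))
        _ = ((n : ℝ) ^ 11)⁻¹ := exp_neg_nat_mul_log hn 11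
  calc μ.real {ω | ∃ i, 4 * m i < ∑ j, symWeight (X · ω) i j}
      ≤ ∑ i, μ.real {ω | 4 * m i < ∑ j, symWeight (X · ω) i j} := by
        rw [Set.ofPred_exists]
        exact measureReal_iUnion_fintype_le _
    _ ≤ ∑ _i : Fin n, ((n : ℝ) ^ 11)⁻¹ := Finset.sum_le_sum fun i _ => hrow i
    _ = ((n : ℝ) ^ 10)⁻¹ := by
        rw [Finset.sum_const, Finset.card_univ, Fintype.card_fin, nsmul_eq_mul]
        field

end RandomWeights

section Kappa

variable {n : ℕ} {θ : Fin n → ℝ} {w : Pair n → ℝ}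

lemma one_le_kappa (hn : 0 < n) (hθ : Antitone θ) : 1 ≤ kappa hn θ := by
  rw [kappa, ← Real.exp_sub]
  exact Real.one_le_exp (sub_nonneg.mpr (hθ (Fin.le_def.mpr (Nat.zero_le _))))

lemma inv_four_mul_kappa_le_sigmoidDeriv (hn : 0 < n) (hθ : Antitone θ) (e : Pair n) :
    1 / (4 * kappa hn θ) ≤ sigmoidDeriv (pairDiff θ e) := by
  have hmax : ∀ i, θ i ≤ θ ⟨0, hn⟩ := fun i => hθ (Fin.le_def.mpr (Nat.zero_le _))
  have hmin : ∀ i, θ ⟨n - 1, Nat.sub_lt hn Nat.one_pos⟩ ≤ θ i := fun i =>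
    hθ (Fin.le_def.mpr (Nat.le_sub_one_of_lt i.2))
  rw [kappa, ← Real.exp_sub]
  refine inv_four_mul_exp_le_sigmoidDeriv ?_
  rw [pairDiff, abs_le]
  constructor <;> linarith [hmax e.1.1, hmin e.1.1, hmax e.1.2, hmin e.1.2]

lemma curvature_le (hw : ∀ e, 0 ≤ w e) (x : Fin n → ℝ) (e : Pair n) : curvature w x e ≤ w e :=
  mul_le_of_le_one_right (hw e) (sigmoidDeriv_le_one _)

lemma energy_symWeight_le_energy_curvature (hn : 0 < n) (hθ : Antitone θ) (hw : ∀ e, 0 ≤ w e)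
    (u : Fin n → ℝ) :
    energy (symWeight w) u ≤ 4 * kappa hn θ * energy (symWeight (curvature w θ)) u := by
  have hκ : 0 < kappa hn θ := one_pos.trans_le (one_le_kappa hn hθ)
  rw [energy_symWeight, energy_symWeight, Finset.mul_sum]
  refine Finset.sum_le_sum fun e _ => ?_
  have hderiv : 1 ≤ sigmoidDeriv (pairDiff θ e) * (4 * kappa hn θ) :=
    (div_le_iff₀ (by positivity)).mp (inv_four_mul_kappa_le_sigmoidDeriv hn hθ e)
  calc w e * pairDiff u e ^ 2
      ≤ w e * pairDiff u e ^ 2 * (sigmoidDeriv (pairDiff θ e) * (4 * kappa hn θ)) :=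
        le_mul_of_one_le_right (mul_nonneg (hw e) (sq_nonneg _)) hderiv
    _ = 4 * kappa hn θ * (curvature w θ e * pairDiff u e ^ 2) := by rw [curvature]; ring

lemma HasSpectralGap.curvature {Λ : ℝ} (hn : 0 < n) (hθ : Antitone θ) (hw : ∀ e, 0 ≤ w e)
    (hgap : HasSpectralGap (symWeight w) Λ) :
    HasSpectralGap (symWeight (curvature w θ)) (Λ / (4 * kappa hn θ)) := by
  intro x hx
  have hκ : 0 < kappa hn θ := one_pos.trans_le (one_le_kappa hn hθ)
  rw [div_mul_eq_mul_div, div_le_iff₀' (by positivity)]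
  exact (hgap x hx).trans (energy_symWeight_le_energy_curvature hn hθ hw x)

/-- Expansion together with bounded degrees: the properties of a weighted graph on which the MLE is
accurate. -/
structure IsWellConnected {V : Type*} [Fintype V] [DecidableEq V] (W : V → V → ℝ) (c D : ℝ) :
    Prop where
  expansion : HasSmallSetExpansion W c
  degree_le : ∀ i, ∑ j, W i j ≤ D

lemma IsWellConnected.hasSpectralGap_curvature {c D : ℝ} (hn : 0 < n) (hθ : Antitone θ)
    (hw : ∀ e, 0 ≤ w e) (hc : 0 ≤ c) (h : IsWellConnected (symWeight w) c D) :
    HasSpectralGap (symWeight (curvature w θ)) (c / (32 * kappa hn θ)) := by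
  convert (h.expansion.hasSpectralGap (symWeight_comm w) (symWeight_nonneg hw) hc).curvature hn hθ
    hw using 1
  rw [div_div]
  ring

lemma IsWellConnected.exists_isApproxGreen_curvature {c D : ℝ} (hn : 2 ≤ n) (hθ : Antitone θ)
    (hw : ∀ e, 0 ≤ w e) (hc : 0 < c) (h : IsWellConnected (symWeight w) c D) {Λ : ℝ}
    (hΛ : Λ = c / (32 * kappa (two_pos.trans_le hn) θ)) (i : Fin n) :
    ∃ u, IsApproxGreen (symWeight (curvature w θ)) i (2 / Λ) (14 * Real.log n * √(D / Λ)) u := by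
  have : Nontrivial (Fin n) := Fin.nontrivial_iff_two_le.mpr hn
  have hκ := one_pos.trans_le (one_le_kappa (two_pos.trans_le hn) hθ)
  have hdeg : ∀ i, ∑ j, symWeight (curvature w θ) i j ≤ D := fun i =>
    (Finset.sum_le_sum fun j _ => symWeight_mono (curvature_le hw θ) i j).trans (h.degree_le i)
  have hgap := h.hasSpectralGap_curvature (two_pos.trans_le hn) hθ hw hc.le
  rw [← hΛ] at hgap
  simpa only [Fintype.card_fin] using hgap.exists_isApproxGreen
    (symWeight_comm _) (symWeight_nonneg (curvature_nonneg hw θ)) (hΛ ▸ by positivity) hdeg i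

end Kappa

section ErrorRadius

/-- The accuracy of the MLE for condition number `κ`, `l = log n` and `N = n q L` comparisons per
item. -/
def errorRadius (κ l N : ℝ) : ℝ := 640 * κ * √(l / N)

variable {κ l Q L m : ℝ}

lemma errorRadius_nonneg (hκ : 0 ≤ κ) (l N : ℝ) : 0 ≤ errorRadius κ l N := by
  unfold errorRadius
  positivity

lemma errorRadius_sq {N : ℝ} (hl : 0 ≤ l) (hN : 0 ≤ N) :
    errorRadius κ l N ^ 2 = 640 ^ 2 * κ ^ 2 * (l / N) := by
  rw [errorRadius, mul_pow, mul_pow, Real.sq_sqrt (by positivity)]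

lemma errorRadius_le_half (hκ : 1 ≤ κ) (hl : 1 / 2 ≤ l) (hQ : 0 < Q) (hL : 0 < L)
    (hQm : Q ≤ m) (hm : 41287680 ^ 2 * κ ^ 4 * m * l ^ 3 ≤ 2 * (Q ^ 2 * L)) :
    errorRadius κ l (Q * L) ≤ 1 / 2 := by
  have hQL : 41287680 ^ 2 * (κ ^ 4 * l ^ 3) ≤ 2 * (Q * L) := by
    refine le_of_mul_le_mul_right ?_ hQ
    calc 41287680 ^ 2 * (κ ^ 4 * l ^ 3) * Q ≤ 41287680 ^ 2 * (κ ^ 4 * l ^ 3) * m := by gcongr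
      _ = 41287680 ^ 2 * κ ^ 4 * m * l ^ 3 := by ring
      _ ≤ 2 * (Q * L) * Q := hm.trans_eq (by ring)
  have hκl : κ ^ 2 * l ≤ κ ^ 4 * (4 * l ^ 3) := by
    gcongr ?_ * ?_
    · exact pow_le_pow_right₀ hκ (by norm_num)
    · nlinarith [mul_nonneg (by linarith : 0 ≤ l) (by linarith : 0 ≤ 2 * l - 1)]
  refine le_of_sq_le_sq ?_ (by norm_num)
  rw [errorRadius_sq (by positivity) (by positivity), ← mul_div_assoc,
    div_le_iff₀ (by positivity)]
  linarith [mul_nonneg (pow_nonneg (by linarith : 0 ≤ κ) 4) (pow_nonneg (by linarith : 0 ≤ l) 3)]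

/- The constant `41287680` is `144 * 14 * 640 * 32`. -/
lemma mul_errorRadius_mul_log_mul_sqrt_le_one (hκ : 1 ≤ κ) (hl : 0 < l) (hQ : 0 < Q) (hL : 0 < L)
    (hm_nonneg : 0 ≤ m) (hm : 41287680 ^ 2 * κ ^ 4 * m * l ^ 3 ≤ 2 * (Q ^ 2 * L)) :
    144 * errorRadius κ l (Q * L) * (14 * l * √(4 * m / (Q / 4 / (32 * κ)))) ≤ 1 := by
  refine le_of_sq_le_sq ?_ zero_le_one
  calc (144 * errorRadius κ l (Q * L) * (14 * l * √(4 * m / (Q / 4 / (32 * κ))))) ^ 2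
      = 41287680 ^ 2 * κ ^ 4 * m * l ^ 3 / (2 * (Q ^ 2 * L)) / κ := by
        rw [mul_pow, mul_pow, mul_pow (14 * l), Real.sq_sqrt (by positivity),
          errorRadius_sq hl.le (by positivity)]
        field
    _ ≤ 1 / 1 := by
        gcongr
        exact div_le_one_of_le₀ hm (by positivity)
    _ = 1 ^ 2 := by norm_num

lemma log_le_errorRadius_sq_div (hκ : 0 < κ) (hl : 0 ≤ l) (hQ : 0 < Q) (hL : 0 < L) :
    11 * l ≤ 2 * L * (errorRadius κ l (Q * L) / 8) ^ 2 /
      (4 * κ * (2 / (Q / 4 / (32 * κ)))) := by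
  have : 2 * L * (errorRadius κ l (Q * L) / 8) ^ 2 / (4 * κ * (2 / (Q / 4 / (32 * κ)))) =
      25 / 2 * l := by
    rw [div_pow, errorRadius_sq hl (by positivity)]
    field
  linarith

lemma recoversTopK_of_norm_sub_le_errorRadius {n K : ℕ} {θ x : Fin n → ℝ} {N : ℝ} (hKn : K < n)
    (hθ : Antitone θ) (hl : 0 ≤ l) (hx : ‖x - θ‖ ≤ errorRadius κ l N)
    (hgap : 0 < scoreGap θ K hKn)
    (hN : 9 * 640 ^ 2 * (κ ^ 2 * l / scoreGap θ K hKn ^ 2) ≤ N) : RecoversTopK x K := by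
  refine recoversTopK_of_norm_sub_le hKn hθ hx ?_
  have hN_nonneg : 0 ≤ N := by refine le_trans ?_ hN; positivity
  have hthree : 3 * errorRadius κ l N ≤ scoreGap θ K hKn := by
    refine le_of_sq_le_sq ?_ hgap.le
    rw [← mul_div_assoc, div_le_iff₀ (by positivity)] at hN
    rw [mul_pow, errorRadius_sq hl hN_nonneg, ← mul_div_assoc, ← mul_div_assoc]
    refine div_le_of_le_mul₀ hN_nonneg (by positivity) ?_
    linarith
  linarith

end ErrorRadius

section BernoulliIndicator

variable {Ω : Type*} [MeasurableSpace Ω] {μ : Measure Ω} {b : Ω → Bool}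

lemma measurable_ite_bool (hb : Measurable b) :
    Measurable fun ω => if b ω then (1 : ℝ) else 0 :=
  (measurable_of_countable fun a : Bool => if a then (1 : ℝ) else 0).comp hb

lemma integral_ite_bool (hb : Measurable b) :
    ∫ ω, (if b ω then (1 : ℝ) else 0) ∂μ = μ.real {ω | b ω = true} := by
  calc ∫ ω, (if b ω then (1 : ℝ) else 0) ∂μ = ∫ ω, {ω | b ω = true}.indicator 1 ω ∂μ := by
        simp only [Set.indicator_apply, Set.mem_ofPred_eq, Pi.one_apply]
    _ = μ.real {ω | b ω = true} := integral_indicator_one (hb (measurableSet_singleton true))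

lemma ite_bool_mem_Icc (a : Bool) : (if a then (1 : ℝ) else 0) ∈ Set.Icc 0 1 := by
  cases a <;> simp

lemma iIndepFun_ite_bool {ι : Type*} {X : ι → Ω → Bool} (h : iIndepFun X μ) :
    iIndepFun (fun i ω => if X i ω then (1 : ℝ) else 0) μ :=
  h.comp (fun _ a => if a then (1 : ℝ) else 0) fun _ => measurable_of_countable _

lemma indepFun_pi_of_iIndepFun_sumElim {ι κ E : Type*} [Finite ι] [Finite κ]
    [MeasurableSpace E] {X : ι → Ω → E} {Y : κ → Ω → E} (hX : ∀ i, Measurable (X i))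
    (hY : ∀ j, Measurable (Y j)) (h : iIndepFun (Sum.elim X Y) μ) :
    IndepFun (fun ω i => X i ω) (fun ω j => Y j ω) μ := by
  have := Fintype.ofFinite ι
  have := Fintype.ofFinite κ
  let S : Finset (ι ⊕ κ) := Finset.univ.map .inl
  let T : Finset (ι ⊕ κ) := Finset.univ.map .inr
  have hST : Disjoint S T := Finset.disjoint_map_inl_map_inr _ _
  have hmeas : ∀ s, Measurable (Sum.elim X Y s) := Sum.rec hX hY
  exact (h.indepFun_finset S T hST hmeas).comp
    (φ := fun (f : S → E) (i : ι) => f ⟨Sum.inl i, by simp [S]⟩)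
    (ψ := fun (f : T → E) (j : κ) => f ⟨Sum.inr j, by simp [T]⟩)
    (by fun_prop) (by fun_prop)

end BernoulliIndicator

section Noise

variable {Ω : Type*} [MeasurableSpace Ω] {μ : Measure Ω} {n L : ℕ} {θ : Fin n → ℝ}
  {outcome : Pair n → Fin L → Ω → Bool}

/-- `L` independent Bradley-Terry-Luce comparisons of every pair, without a comparison graph. -/
structure IsBTLSample (μ : Measure Ω) (θ : Fin n → ℝ) (outcome : Pair n → Fin L → Ω → Bool) :
    Prop where
  measurable : ∀ e l, Measurable (outcome e l)
  prob : ∀ e l, μ.real {ω | outcome e l ω = true} = winProb θ e.1.2 e.1.1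
  indep : iIndepFun (fun s : Pair n × Fin L => outcome s.1 s.2) μ

lemma IsBTLSample.pairScore_mul (h : IsBTLSample μ θ outcome) (w : Pair n → ℝ) (u : Fin n → ℝ)
    (ω : Ω) :
    ∑ e, pairScore w (outcome · · ω) θ e * pairDiff u e =
      ∑ s : Pair n × Fin L, -(1 / L * (w s.1 * pairDiff u s.1)) *
        ((if outcome s.1 s.2 ω then (1 : ℝ) else 0) -
          ∫ ω', (if outcome s.1 s.2 ω' then (1 : ℝ) else 0) ∂μ) := by
  rw [Fintype.sum_prod_type]
  refine Finset.sum_congr rfl fun e _ => ?_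
  rw [ClusterRanking.pairScore_mul]
  refine Finset.sum_congr rfl fun l _ => ?_
  simp only [integral_ite_bool (h.measurable e l), h.prob, winProb_eq_sigmoid, pairDiff]
  ring

lemma IsBTLSample.measureReal_le_abs_sum_pairScore_mul_le [IsProbabilityMeasure μ]
    (h : IsBTLSample μ θ outcome) (hL : 0 < L) (w : Pair n → ℝ) (u : Fin n → ℝ) {v s : ℝ}
    (hv : ∑ e, (w e * pairDiff u e) ^ 2 ≤ v) (hs : 0 ≤ s) :
    μ.real {ω | s ≤ |∑ e, pairScore w (outcome · · ω) θ e * pairDiff u e|} ≤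
      2 * Real.exp (-(2 * L * s ^ 2 / v)) := by
  have hcoeff : ∑ t : Pair n × Fin L, (-(1 / L * (w t.1 * pairDiff u t.1))) ^ 2 ≤ v / L :=
    calc ∑ t : Pair n × Fin L, (-(1 / L * (w t.1 * pairDiff u t.1))) ^ 2
        = (∑ e, (w e * pairDiff u e) ^ 2) / L := by
          rw [Fintype.sum_prod_type, Finset.sum_div]
          refine Finset.sum_congr rfl fun e _ => ?_
          simp only [Finset.sum_const, Finset.card_univ, Fintype.card_fin, nsmul_eq_mul]
          field
      _ ≤ v / L := by gcongr
  simp only [h.pairScore_mul]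
  refine (measureReal_le_abs_sum_mul_sub_integral_le
    (fun t : Pair n × Fin L => measurable_ite_bool (h.measurable t.1 t.2))
    (fun t ω => ite_bool_mem_Icc (outcome t.1 t.2 ω)) (iIndepFun_ite_bool h.indep)
    _ hcoeff hs).trans_eq ?_
  rw [div_div_eq_mul_div, mul_right_comm]

lemma sum_sq_mul_pairDiff_le_energy {w : Pair n → ℝ} (hw : ∀ e, w e ∈ Set.Icc 0 1)
    (u : Fin n → ℝ) : ∑ e, (w e * pairDiff u e) ^ 2 ≤ energy (symWeight w) u := by
  rw [energy_symWeight]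
  refine Finset.sum_le_sum fun e _ => ?_
  rw [mul_pow]
  gcongr
  exact pow_le_of_le_one (hw e).1 (hw e).2 two_ne_zero

lemma IsBTLSample.measureReal_exists_lt_abs_sum_pairScore_mul_le [IsProbabilityMeasure μ]
    (h : IsBTLSample μ θ outcome) (hn : 0 < n) (hL : 0 < L) {w : Pair n → ℝ}
    (hw : ∀ e, w e ∈ Set.Icc 0 1) {u : Fin n → Fin n → ℝ} {E s : ℝ}
    (hE : ∀ i, energy (symWeight w) (u i) ≤ E) (hs : 0 ≤ s)
    (hlog : 11 * Real.log n ≤ 2 * L * s ^ 2 / E) :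
    μ.real {ω | ∃ i, s < |∑ e, pairScore w (outcome · · ω) θ e * pairDiff (u i) e|} ≤
      2 * ((n : ℝ) ^ 10)⁻¹ := by
  have htail : ∀ i, μ.real {ω | s < |∑ e, pairScore w (outcome · · ω) θ e * pairDiff (u i) e|} ≤
      2 * ((n : ℝ) ^ 11)⁻¹ := fun i =>
    calc μ.real {ω | s < |∑ e, pairScore w (outcome · · ω) θ e * pairDiff (u i) e|}
        ≤ μ.real {ω | s ≤ |∑ e, pairScore w (outcome · · ω) θ e * pairDiff (u i) e|} :=
          measureReal_mono (Set.ofPred_subset_ofPred.mpr fun ω => le_of_lt)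
      _ ≤ 2 * Real.exp (-(2 * L * s ^ 2 / E)) :=
          h.measureReal_le_abs_sum_pairScore_mul_le hL w (u i)
            ((sum_sq_mul_pairDiff_le_energy hw (u i)).trans (hE i)) hs
      _ ≤ 2 * Real.exp (-((11 : ℕ) * Real.log n)) := by
          gcongr
          exact_mod_cast hlog
      _ = 2 * ((n : ℝ) ^ 11)⁻¹ := by rw [exp_neg_nat_mul_log hn]
  calc μ.real {ω | ∃ i, s < |∑ e, pairScore w (outcome · · ω) θ e * pairDiff (u i) e|}
      ≤ ∑ i, μ.real {ω | s < |∑ e, pairScore w (outcome · · ω) θ e * pairDiff (u i) e|} := by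
        rw [Set.ofPred_exists]
        exact measureReal_iUnion_fintype_le _
    _ ≤ ∑ _i : Fin n, 2 * ((n : ℝ) ^ 11)⁻¹ := Finset.sum_le_sum fun i _ => htail i
    _ = 2 * ((n : ℝ) ^ 10)⁻¹ := by
        rw [Finset.sum_const, Finset.card_univ, Fintype.card_fin, nsmul_eq_mul]
        field

end Noise

section RandomGraph

variable {Ω : Type*} [MeasurableSpace Ω] {μ : Measure Ω} [IsProbabilityMeasure μ] {n L : ℕ}
  {θ : Fin n → ℝ}

/-- The unit weights of a comparison graph, for which the weighted MLE is the vanilla MLE. -/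
def graphWeight (g : Pair n → Bool) (e : Pair n) : ℝ := if g e then 1 else 0

lemma graphWeight_mem_Icc (g : Pair n → Bool) (e : Pair n) : graphWeight g e ∈ Set.Icc 0 1 :=
  ite_bool_mem_Icc (g e)

/-- The conclusion of the recovery theorem for one graph `g` and one set of results `y`: the MLE
exists, is unique, and is within `ε` of `θ` in the sup norm. -/
def HasMLENear (g : Pair n → Bool) (y : Pair n → Fin L → Bool) (θ : Fin n → ℝ) (ε : ℝ) : Prop :=
  (∃! x, IsMLE g y x) ∧ ∀ x, IsMLE g y x → ‖x - θ‖ ≤ ε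

lemma measureReal_not_isWellConnected_le (hn : 0 < n) {edge : Pair n → Ω → Bool}
    (hedge : ∀ e, Measurable (edge e)) (hindep : iIndepFun edge μ) {q m : ℝ}
    (hq : ∀ e, q ≤ μ.real {ω | edge e ω = true})
    (hm : ∀ i, ∑ j, symWeight (fun e => μ.real {ω | edge e ω = true}) i j ≤ m)
    (hqm : n * q ≤ m) (hnq : 480 * Real.log n ≤ n * q) :
    μ.real {ω | ¬IsWellConnected (symWeight (graphWeight (edge · ω))) (n * q / 4) (4 * m)} ≤
      10 * ((n : ℝ) ^ 10)⁻¹ := by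
  have hmeas := fun e => measurable_ite_bool (hedge e)
  have hmem := fun e ω => ite_bool_mem_Icc (edge e ω)
  simp only [← integral_ite_bool (hedge _)] at hq hm
  have hlog : 0 ≤ Real.log n := Real.log_natCast_nonneg n
  have hexp := measureReal_not_hasSmallSetExpansion_le hn hmeas hmem (iIndepFun_ite_bool hindep)
    hq hnq
  have hdeg := measureReal_exists_lt_sum_symWeight_le hn hmeas hmem (iIndepFun_ite_bool hindep)
    hm fun _ => by linarith
  have hcover : {ω | ¬IsWellConnected (symWeight (graphWeight (edge · ω))) (n * q / 4) (4 * m)} ⊆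
      {ω | ¬HasSmallSetExpansion (symWeight (graphWeight (edge · ω))) (n * q / 4)} ∪
        {ω | ∃ i, 4 * m < ∑ j, symWeight (graphWeight (edge · ω)) i j} := by
    intro ω hω
    by_contra h
    simp only [Set.mem_union, Set.mem_ofPred_eq, not_or, not_not, not_exists, not_lt] at h
    exact hω ⟨h.1, h.2⟩
  have := (measureReal_mono hcover).trans (measureReal_union_le (μ := μ) _ _)
  unfold graphWeight at *
  linarith

/- The approximate Green functions depend only on the graph, so for a fixed graph Hoeffding's
inequality applies to the noise tested against them. -/
lemma IsBTLSample.measureReal_not_hasMLENear_le {outcome : Pair n → Fin L → Ω → Bool}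
    (h : IsBTLSample μ θ outcome) (hn : 2 ≤ n) (hL : 0 < L) (hθ : Antitone θ)
    (hθ_sum : ∑ i, θ i = 0) {g : Pair n → Bool} {c D Λ ε : ℝ} (hc : 0 < c)
    (hg : IsWellConnected (symWeight (graphWeight g)) c D)
    (hΛ : Λ = c / (32 * kappa (two_pos.trans_le hn) θ)) (hε_nonneg : 0 ≤ ε) (hε : ε ≤ 1 / 2)
    (hB : 144 * ε * (14 * Real.log n * √(D / Λ)) ≤ 1)
    (hlog : 11 * Real.log n ≤
      2 * L * (ε / 8) ^ 2 / (4 * kappa (two_pos.trans_le hn) θ * (2 / Λ))) :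
    μ.real {ω | ¬HasMLENear g (outcome · · ω) θ ε} ≤ 2 * ((n : ℝ) ^ 10)⁻¹ := by
  have hn_pos : 0 < n := two_pos.trans_le hn
  have hκ : 0 < kappa hn_pos θ := one_pos.trans_le (one_le_kappa hn_pos hθ)
  have hw : ∀ e, graphWeight g e ∈ Set.Icc 0 1 := graphWeight_mem_Icc g
  have hgap := hg.hasSpectralGap_curvature hn_pos hθ (fun e => (hw e).1) hc.le
  have hΛ_pos : 0 < Λ := hΛ ▸ by positivity
  rw [← hΛ] at hgap
  choose u hu using hg.exists_isApproxGreen_curvature hn hθ (fun e => (hw e).1) hc hΛ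
  have henergy : ∀ i, energy (symWeight (graphWeight g)) (u i) ≤
      4 * kappa hn_pos θ * (2 / Λ) := fun i =>
    (energy_symWeight_le_energy_curvature hn_pos hθ (fun e => (hw e).1) (u i)).trans
      (mul_le_mul_of_nonneg_left (hu i).energy_le (by positivity))
  refine (measureReal_mono fun ω hω => ?_).trans
    (h.measureReal_exists_lt_abs_sum_pairScore_mul_le hn_pos hL hw henergy
      (by positivity : 0 ≤ ε / 8) hlog)
  by_contra hnoise
  simp only [Set.mem_ofPred_eq, not_exists, not_lt] at hnoise
  obtain ⟨x, hx, hnear, hunique⟩ := exists_isWeightedMLE_near (fun e => (hw e).1) hL hθ_sum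
    hε_nonneg hε hB hΛ_pos hgap hu hnoise
  exact hω ⟨⟨x, hx, hunique⟩, fun x' hx' => hunique x' hx' ▸ hnear⟩

lemma IsBTLSample.measureReal_not_hasMLENear_errorRadius_le {outcome : Pair n → Fin L → Ω → Bool}
    (h : IsBTLSample μ θ outcome) (hn : 2 ≤ n) (hL : 0 < L) (hθ : Antitone θ)
    (hθ_sum : ∑ i, θ i = 0) {g : Pair n → Bool} {Q m : ℝ} (hQ : 0 < Q) (hQm : Q ≤ m)
    (hmL : 41287680 ^ 2 * kappa (two_pos.trans_le hn) θ ^ 4 * m * Real.log n ^ 3 ≤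
      2 * (Q ^ 2 * L))
    (hg : IsWellConnected (symWeight (graphWeight g)) (Q / 4) (4 * m)) :
    μ.real {ω | ¬HasMLENear g (outcome · · ω) θ
      (errorRadius (kappa (two_pos.trans_le hn) θ) (Real.log n) (Q * L))} ≤
      2 * ((n : ℝ) ^ 10)⁻¹ := by
  have hκ := one_le_kappa (two_pos.trans_le hn) hθ
  have hκ_pos := one_pos.trans_le hκ
  have hlog : 1 / 2 ≤ Real.log n := by
    have : Real.log 2 ≤ Real.log n := Real.log_le_log two_pos (by exact_mod_cast hn)
    linarith [Real.log_two_gt_d9]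
  have hlog_pos : 0 < Real.log n := one_half_pos.trans_le hlog
  have hL' : (0 : ℝ) < L := by exact_mod_cast hL
  exact h.measureReal_not_hasMLENear_le hn hL hθ hθ_sum (by positivity) hg rfl
    (errorRadius_nonneg hκ_pos.le _ _) (errorRadius_le_half hκ hlog hQ hL' hQm hmL)
    (mul_errorRadius_mul_log_mul_sqrt_le_one hκ hlog_pos hQ hL' (hQ.le.trans hQm) hmL)
    (log_le_errorRadius_sq_div hκ_pos hlog_pos.le hQ hL')

theorem IsBTLSample.one_sub_le_measureReal_hasMLENear {edge : Pair n → Ω → Bool}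
    {outcome : Pair n → Fin L → Ω → Bool} (h : IsBTLSample μ θ outcome)
    (hedge : ∀ e, Measurable (edge e)) (hedge_indep : iIndepFun edge μ)
    (hindep : IndepFun (fun ω e => edge e ω) (fun ω e l => outcome e l ω) μ) (hn : 2 ≤ n)
    (hL : 0 < L) (hθ : Antitone θ) (hθ_sum : ∑ i, θ i = 0) {q m : ℝ}
    (hq : ∀ e, q ≤ μ.real {ω | edge e ω = true})
    (hm : ∀ i, ∑ j, symWeight (fun e => μ.real {ω | edge e ω = true}) i j ≤ m)
    (hqm : n * q ≤ m) (hnq : 480 * Real.log n ≤ n * q)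
    (hmL : 41287680 ^ 2 * kappa (two_pos.trans_le hn) θ ^ 4 * m * Real.log n ^ 3 ≤
      2 * ((n * q) ^ 2 * L)) :
    1 - 12 * ((n : ℝ) ^ 10)⁻¹ ≤ μ.real {ω | HasMLENear (edge · ω) (outcome · · ω) θ
      (errorRadius (kappa (two_pos.trans_le hn) θ) (Real.log n) (n * q * L))} := by
  have hlog : 0 < Real.log n := Real.log_pos (by exact_mod_cast hn)
  set ε := errorRadius (kappa (two_pos.trans_le hn) θ) (Real.log n) (n * q * L)
  let connected : Set (Pair n → Bool) :=
    {g | IsWellConnected (symWeight (graphWeight g)) (n * q / 4) (4 * m)}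
  let bad : Set ((Pair n → Bool) × (Pair n → Fin L → Bool)) :=
    {s | s.1 ∈ connected ∧ ¬HasMLENear s.1 s.2 θ ε}
  have hfixed : ∀ g, μ.real {ω | (g, (outcome · · ω)) ∈ bad} ≤ 2 * ((n : ℝ) ^ 10)⁻¹ := by
    intro g
    by_cases hg : g ∈ connected
    · simpa only [bad, Set.mem_ofPred_eq, hg, true_and] using
        h.measureReal_not_hasMLENear_errorRadius_le hn hL hθ hθ_sum (by linarith) hqm hmL hg
    · simp only [bad, Set.mem_ofPred_eq, hg, false_and, Set.ofPred_false, measureReal_empty]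
      positivity
  have hbad : μ.real {ω | ((edge · ω), (outcome · · ω)) ∈ bad} ≤ 2 * ((n : ℝ) ^ 10)⁻¹ :=
    measureReal_prodMk_mem_le_of_indepFun (measurable_pi_lambda _ hedge)
      (measurable_pi_lambda _ fun e => measurable_pi_lambda _ (h.measurable e)) hindep
      bad.toFinite.measurableSet hfixed
  have hgraph : μ.real {ω | (edge · ω) ∉ connected} ≤ 10 * ((n : ℝ) ^ 10)⁻¹ :=
    measureReal_not_isWellConnected_le (two_pos.trans_le hn) hedge hedge_indep hq hm hqm hnq
  have hcover : Set.univ ⊆ {ω | HasMLENear (edge · ω) (outcome · · ω) θ ε} ∪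
      ({ω | (edge · ω) ∉ connected} ∪ {ω | ((edge · ω), (outcome · · ω)) ∈ bad}) := by
    intro ω _
    simp only [bad, Set.mem_union, Set.mem_ofPred_eq]
    tauto
  have htotal := measureReal_mono (μ := μ) hcover
  rw [probReal_univ] at htotal
  have hunion := htotal.trans ((measureReal_union_le _ _).trans
    (add_le_add_right (measureReal_union_le _ _) _))
  linarith

end RandomGraph

section ClusteredGraph

variable {n k : ℕ} {φ : Fin n → Fin k} {p : Fin k → ℝ} {q : ℝ}

lemma sum_symWeight_edgeProb_le (hq : 0 ≤ q) (hp : ∀ t, 0 ≤ p t) (i : Fin n) :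
    ∑ j, symWeight (edgeProb φ p q) i j ≤ clusterSize φ (φ i) * p (φ i) + n * q := by
  have hentry : ∀ j, symWeight (edgeProb φ p q) i j ≤ (if φ j = φ i then p (φ i) else 0) + q := by
    intro j
    rcases lt_trichotomy i j with h | h | h
    · by_cases hφ : φ j = φ i <;> simp [symWeight, lowerWeight, edgeProb, h, h.not_gt, hφ, hq]
    · simp only [symWeight, lowerWeight, h, lt_self_iff_false, dite_false, if_true]
      linarith [hp (φ j)]
    · by_cases hφ : φ i = φ j
      · simp [symWeight, lowerWeight, edgeProb, h, h.not_gt, hφ, hq]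
      · simp [symWeight, lowerWeight, edgeProb, h, h.not_gt, hφ, Ne.symm hφ]
  calc ∑ j, symWeight (edgeProb φ p q) i j
      ≤ ∑ j, ((if φ j = φ i then p (φ i) else 0) + q) := Finset.sum_le_sum fun j _ => hentry j
    _ = clusterSize φ (φ i) * p (φ i) + n * q := by
        rw [Finset.sum_add_distrib, ← Finset.sum_filter, clusterSize]
        simp

variable {Ω : Type*} [MeasurableSpace Ω] {μ : Measure Ω} {L : ℕ} {θ : Fin n → ℝ}
  {edge : Pair n → Ω → Bool} {outcome : Pair n → Fin L → Ω → Bool}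

lemma IsClusteredBTL.isBTLSample (h : IsClusteredBTL μ φ p q θ edge outcome) :
    IsBTLSample μ θ outcome where
  measurable := h.measurable_outcome
  prob := h.prob_outcome
  indep := h.indep.precomp (g := Sum.inr) Sum.inr_injective

lemma IsClusteredBTL.indepFun_edge_outcome (h : IsClusteredBTL μ φ p q θ edge outcome) :
    IndepFun (fun ω e => edge e ω) (fun ω e l => outcome e l ω) μ :=
  (indepFun_pi_of_iIndepFun_sumElim (Y := fun s : Pair n × Fin L => outcome s.1 s.2)
    h.measurable_edge (fun s => h.measurable_outcome s.1 s.2) h.indep).comp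
    (φ := id) (ψ := fun (f : Pair n × Fin L → Bool) (e : Pair n) (l : Fin L) => f (e, l))
    measurable_id (by fun_prop)

theorem IsClusteredBTL.one_sub_le_measureReal_hasMLENear [IsProbabilityMeasure μ]
    (h : IsClusteredBTL μ φ p q θ edge outcome) (hn : 2 ≤ n) (hL : 0 < L) (hqp : ∀ t, q ≤ p t)
    (hθ : Antitone θ) (hθ_sum : ∑ i, θ i = 0) (hnq : 480 * Real.log n ≤ n * q)
    (hacross : 41287680 ^ 2 * kappa (two_pos.trans_le hn) θ ^ 4 * Real.log n ^ 3 ≤ n * q * L)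
    (hwithin : ∀ t, 41287680 ^ 2 * kappa (two_pos.trans_le hn) θ ^ 4 *
      (clusterSize φ t * p t) * Real.log n ^ 3 ≤ (n : ℝ) ^ 2 * q ^ 2 * L) :
    1 - 12 * ((n : ℝ) ^ 10)⁻¹ ≤ μ.real {ω | HasMLENear (edge · ω) (outcome · · ω) θ
      (errorRadius (kappa (two_pos.trans_le hn) θ) (Real.log n) (n * q * L))} := by
  have hκ := one_pos.trans_le (one_le_kappa (two_pos.trans_le hn) hθ)
  have hlog : 0 < Real.log n := Real.log_pos (by exact_mod_cast hn)
  have hnq_pos : 0 < n * q := by linarith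
  have hq : 0 ≤ q := nonneg_of_mul_nonneg_right hnq_pos.le (by positivity)
  set a := 41287680 ^ 2 * kappa (two_pos.trans_le hn) θ ^ 4 * Real.log n ^ 3 with ha
  have ha_pos : 0 < a := by positivity
  have hdegree : ∀ t, clusterSize φ t * p t ≤ (n * q) ^ 2 * L / a := fun t => by
    rw [le_div_iff₀ ha_pos]
    linarith [hwithin t]
  have hdegree_across : n * q ≤ (n * q) ^ 2 * L / a := by
    rw [le_div_iff₀ ha_pos]
    linarith [mul_le_mul_of_nonneg_left hacross hnq_pos.le]
  refine h.isBTLSample.one_sub_le_measureReal_hasMLENear (m := 2 * ((n * q) ^ 2 * L / a))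
    h.measurable_edge (h.indep.precomp (g := Sum.inl) Sum.inl_injective) h.indepFun_edge_outcome
    hn hL hθ hθ_sum (fun e => ?_) (fun i => ?_) (by linarith) hnq (le_of_eq ?_)
  · rw [h.prob_edge, edgeProb]
    split_ifs
    exacts [hqp _, le_rfl]
  · simp only [h.prob_edge]
    linarith [sum_symWeight_edgeProb_le (φ := φ) hq (fun t => hq.trans (hqp t)) i,
      hdegree (φ i)]
  · rw [ha]
    field

end ClusteredGraph

end ClusterRanking

end

theorem mainTheorem8_general :
    ∃ C₁ C₂ C₃ C₄ C₅ : ℝ, 0 < C₁ ∧ 0 < C₂ ∧ 0 < C₃ ∧ 0 < C₄ ∧ 0 < C₅ ∧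
      ∀ (Ω : Type*) [MeasurableSpace Ω] (μ : Measure Ω) [IsProbabilityMeasure μ]
        (n k L : ℕ) (hn : 0 < n) (_ : 0 < L)
        (φ : Fin n → Fin k) (p : Fin k → ℝ) (q : ℝ) (θ : Fin n → ℝ)
        (edge : ClusterRanking.Pair n → Ω → Bool)
        (outcome : ClusterRanking.Pair n → Fin L → Ω → Bool),
        (∀ t, q ≤ p t) → Antitone θ → ∑ i, θ i = 0 →
        ClusterRanking.IsClusteredBTL μ φ p q θ edge outcome →
        C₁ * Real.log n ≤ n * q →
        C₂ * ClusterRanking.kappa hn θ ^ 4 * Real.log n ^ 3 ≤ n * q * L →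
        (∀ t, C₂ * ClusterRanking.kappa hn θ ^ 4 *
            (ClusterRanking.clusterSize φ t * p t) * Real.log n ^ 3 ≤
          (n : ℝ) ^ 2 * q ^ 2 * L) →
        1 - C₅ * ((n : ℝ) ^ 10)⁻¹ ≤ μ.real {ω |
          (∃! x : Fin n → ℝ,
            ClusterRanking.IsMLE (fun e => edge e ω) (fun e l => outcome e l ω) x) ∧
          ∀ x : Fin n → ℝ,
            ClusterRanking.IsMLE (fun e => edge e ω) (fun e l => outcome e l ω) x →
            ‖x - θ‖ ≤ C₃ * ClusterRanking.kappa hn θ * √(Real.log n / (n * q * L)) ∧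
            ∀ (K : ℕ) (_ : 1 ≤ K) (hKn : K < n),
              0 < ClusterRanking.scoreGap θ K hKn →
              C₄ * (ClusterRanking.kappa hn θ ^ 2 * n * Real.log n /
                  ClusterRanking.scoreGap θ K hKn ^ 2) ≤ (n : ℝ) ^ 2 * q * L →
              ClusterRanking.RecoversTopK x K} := by
  refine ⟨480, 41287680 ^ 2, 640, 9 * 640 ^ 2, 12, by norm_num, by norm_num, by norm_num,
    by norm_num, by norm_num, ?_⟩
  intro Ω _ μ _ n k L hn hL φ p q θ edge outcome hqp hθ hθ_sum hbtl hnq hacross hwithin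
  rcases Nat.lt_or_ge n 2 with hn1 | hn2
  · obtain rfl : n = 1 := by lia
    exact (by norm_num : (1 : ℝ) - 12 * (((1 : ℕ) : ℝ) ^ 10)⁻¹ ≤ 0).trans measureReal_nonneg
  refine (hbtl.one_sub_le_measureReal_hasMLENear hn2 hL hqp hθ hθ_sum hnq hacross hwithin).trans
    (measureReal_mono fun ω hω => ⟨hω.1, fun x hx => ⟨hω.2 x hx, fun K _ hKn hgap hK => ?_⟩⟩)
  refine ClusterRanking.recoversTopK_of_norm_sub_le_errorRadius hKn hθ
    (Real.log_natCast_nonneg n) (hω.2 x hx) hgap ?_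
  have hn_pos : (0 : ℝ) < n := Nat.cast_pos.mpr hn
  refine le_of_mul_le_mul_left ?_ hn_pos
  linear_combination hK

theorem mainTheorem8 :
    ∃ C₁ C₂ C₃ C₄ C₅ : ℝ, 0 < C₁ ∧ 0 < C₂ ∧ 0 < C₃ ∧ 0 < C₄ ∧ 0 < C₅ ∧
      ∀ (Ω : Type*) [MeasurableSpace Ω] (μ : Measure Ω) [IsProbabilityMeasure μ]
        (n k L : ℕ) (hn : 0 < n) (_hL : 0 < L)
        (φ : Fin n → Fin k) (p : Fin k → ℝ) (q : ℝ) (θ : Fin n → ℝ)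
        (edge : ClusterRanking.Pair n → Ω → Bool)
        (outcome : ClusterRanking.Pair n → Fin L → Ω → Bool),
        0 ≤ q → (∀ t, q < p t) → (∀ t, p t ≤ 1) →
        Antitone θ → ∑ i, θ i = 0 →
        ClusterRanking.IsClusteredBTL μ φ p q θ edge outcome →
        C₁ * Real.log n ≤ n * q →
        (∀ t, C₁ * Real.log n ≤ ClusterRanking.clusterSize φ t * p t) →
        C₂ * ClusterRanking.kappa hn θ ^ 4 * Real.log n ^ 3 ≤ n * q * L →
        (∀ t, C₂ * ClusterRanking.kappa hn θ ^ 4 *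
            (ClusterRanking.clusterSize φ t * p t) * Real.log n ^ 3 ≤
          (n : ℝ) ^ 2 * q ^ 2 * L) →
        1 - C₅ * ((n : ℝ) ^ 10)⁻¹ ≤ μ.real {ω |
          (∃! x : Fin n → ℝ,
            ClusterRanking.IsMLE (fun e => edge e ω) (fun e l => outcome e l ω) x) ∧
          ∀ x : Fin n → ℝ,
            ClusterRanking.IsMLE (fun e => edge e ω) (fun e l => outcome e l ω) x →
            ‖x - θ‖ ≤ C₃ * ClusterRanking.kappa hn θ * √(Real.log n / (n * q * L)) ∧
            ∀ (K : ℕ) (_ : 1 ≤ K) (hKn : K < n),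
              0 < ClusterRanking.scoreGap θ K hKn →
              C₄ * (ClusterRanking.kappa hn θ ^ 2 * n * Real.log n /
                  ClusterRanking.scoreGap θ K hKn ^ 2) ≤ (n : ℝ) ^ 2 * q * L →
              ClusterRanking.RecoversTopK x K} := by
  obtain ⟨C₁, C₂, C₃, C₄, C₅, h₁, h₂, h₃, h₄, h₅, h⟩ := mainTheorem8_general
  exact ⟨C₁, C₂, C₃, C₄, C₅, h₁, h₂, h₃, h₄, h₅,
    fun Ω _ μ _ n k L hn hL φ p q θ edge outcome _ hqp _ hθ hθ_sum hbtl hnq _ =>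
      h Ω μ n k L hn hL φ p q θ edge outcome (fun t => (hqp t).le) hθ hθ_sum hbtl hnq⟩
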